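/- Let $I=[0,1]$, write $\|\cdot\|$ for the norm of $L^2(I)$, $|||R|||^2=\iint_{I^2}R(s,t)^2\,ds\,dt$ for $R\in L^2(I^2)$, and $(f\otimes g)(s,t)=f(s)g(t)$. Let $X,Y$ be $L^2(I)$-valued random variables on a probability space with $\mathrm E\|X\|^2<\infty$ and $\mathrm E\|Y\|^2<\infty$ that satisfy the functional linear regression model $$\mathrm E(Y\mid X)(s)=\mathrm E\{Y(s)\}+\int_I b(s,t)\,[X(t)-\mathrm E\{X(t)\}]\,dt$$ (an almost sure equality of $L^2(I)$-valued random variables), where $b\in L^2(I^2)$. Put $\mathcal E=Y-\mathrm E(Y\mid X)$. Let $K(s,t)=\mathrm{Cov}\{X(s),X(t)\}=\sum_{k\ge1}\kappa_k\phi_k(s)\phi_k(t)$ be the spectral expansion of the covariance function of $X$ in $L^2(I^2)$, where the eigenvalues $\kappa_1\ge\kappa_2\ge\cdots\ge0$ tend to zero and $(\phi_k)_{k\ge1}$ is an orthonormal basis of $L^2(I)$ consisting of corresponding eigenfunctions. Let $\xi_k=\int_I[X(t)-\mathrm E\{X(t)\}]\phi_k(t)\,dt$ and $b_{j,k}=\iint_{I^2}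 b(s,t)\phi_j(s)\phi_k(t)\,ds\,dt$. Suppose that there are constants $\alpha>1$, $\beta>\alpha/2+1$, $\gamma>1/2$ and $C_1>1$ such that, for all $j,k\ge1$, $$\mathrm E(\|\mathcal E\|^2\mid X)\le C_1\ \text{almost surely},\qquad \mathrm E(\xi_k^4)\le C_1\kappa_k^2,$$ $$\kappa_k\le C_1k^{-\alpha},\qquad \kappa_k-\kappa_{k+1}\ge C_1^{-1}k^{-\alpha-1},\qquad |b_{j,k}|\le C_1j^{-\gamma}k^{-\beta}.$$ Let $(X_1,Y_1),(X_2,Y_2),\dots$ be independent copies of $(X,Y)$. For each $n$ let $\overline X=n^{-1}\sum_{i=1}^nX_i$, let $\hat K=n^{-1}\sum_{i=1}^n(X_i-\overline X)\otimes(X_i-\overline X)=\sum_{k\ge1}\hat\kappa_k\,\hat\phi_k\otimes\hat\phi_k$ be a spectral expansion of the empirical covariance function, where $\hat\kappa_1\ge\hat\kappa_2\ge\cdots\ge0$ tend to zero and $(\hat\phi_k)_{k\ge1}$ is an orthonormal basis of $L^2(I)$ consisting of corresponding eigenfunctions, let $\hat\xi_{i,k}=\int_I\{X_i(t)-\overline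 X(t)\}\hat\phi_k(t)\,dt$, and define the single-truncation estimator $$\hat b(s,t)=\sum_{k=1}^{m_n}\frac{n^{-1}\sum_{i=1}^n\hat\xi_{i,k}Y_i(s)}{\hat\kappa_k}\,\hat\phi_k(t)$$ (summands with $\hat\kappa_k=0$ are read as $0$). 1. If the (deterministic) integers $m_n$ satisfy $m_n\to\infty$ and $m_n=o\{n^{1/(2\alpha+2)}\}$, then $$|||\hat b-b|||^2=O_{\mathrm P}\{n^{-1}m_n^{\alpha+1}+m_n^{-2\beta+1}\}.$$ 2. If $m_n\sim n^{1/(\alpha+2\beta)}$, that is, if $m_n/n^{1/(\alpha+2\beta)}$ is bounded and bounded away from zero for large $n$, then $$|||\hat b-b|||^2=O_{\mathrm P}\{n^{-(2\beta-1)/(\alpha+2\beta)}\},$$ a rate that does not depend on $\gamma$. Here $Z_n=O_{\mathrm P}(a_n)$ means that for every $\varepsilon>0$ there is $M>0$ with $\mathrm P(|Z_n|>Ma_n)\le\varepsilon$ for all sufficiently large $n$. -/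

import Mathlib

open MeasureTheory ProbabilityTheory Filter Asymptotics Topology

noncomputable section

namespace FunctionalRegression

/-- The unit interval `I = [0,1]`, carrying Lebesgue measure. -/
abbrev I : Type := unitInterval

/-- The Hilbert space `L²(I)`. -/
abbrev L2I : Type := Lp ℝ 2 (volume : Measure I)

/-- The Hilbert space `L²(I²)`; its norm is `|||R||| = (∬ R(s,t)² ds dt)^{1/2}`. -/
abbrev L2I2 : Type := Lp ℝ 2 (volume : Measure (I × I))

/-- `L²(I)` carries its Borel σ-algebra. -/
instance : MeasurableSpace L2I := borel L2I

instance : BorelSpace L2I := ⟨rfl⟩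

theorem memLp_tensor (f g : L2I) :
    MemLp (fun p : I × I => f p.1 * g p.2) 2 (volume : Measure (I × I)) := by
  have hf := Lp.memLp f
  have hg := Lp.memLp g
  have hm : AEStronglyMeasurable (fun p : I × I => f p.1 * g p.2)
      (volume : Measure (I × I)) :=
    (hf.1.comp_fst (ν := (volume : Measure I))).mul (hg.1.comp_snd (μ := (volume : Measure I)))
  rw [memLp_two_iff_integrable_sq hm]
  have h := hf.integrable_sq.mul_prod hg.integrable_sq
  refine h.congr (Eventually.of_forall fun p => ?_)
  simp only [mul_pow]

/-- The function `(f ⊗ g)(s,t) = f(s) g(t)` as an element of `L²(I²)`. -/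
def tensor (f g : L2I) : L2I2 := (memLp_tensor f g).toLp _

/-- `(κ, φ)` is a spectral expansion of the kernel `R`: `κ` is a non-increasing sequence of
non-negative numbers tending to zero, `φ` is an orthonormal basis of `L²(I)`,
`∫ R(s,t) φ_k(t) dt = κ_k φ_k(s)` as elements of `L²(I)`, and
`R = ∑ κ_k φ_k ⊗ φ_k` in `L²(I²)`. The index `k : ℕ` starts at `0`, so `κ k` is the
`(k+1)`-st largest eigenvalue. -/
structure IsSpectralExpansion (R : L2I2) (κ : ℕ → ℝ) (φ : HilbertBasis ℕ ℝ L2I) : Prop where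
  antitone : Antitone κ
  nonneg : ∀ k, 0 ≤ κ k
  tendsto_zero : Tendsto κ atTop (𝓝 0)
  eigen : ∀ k, ∀ᵐ s : I, ∫ t : I, R (s, t) * φ k t = κ k * φ k s
  hasSum : HasSum (fun k => κ k • tensor (φ k) (φ k)) R

/-- The coefficient `b_{j,k} = ∬ b(s,t) φ_j(s) φ_k(t) ds dt`. -/
def coef (φ : HilbertBasis ℕ ℝ L2I) (b : L2I2) (j k : ℕ) : ℝ :=
  ∫ p : I × I, b p * (φ j p.1 * φ k p.2)

section Population

variable {Ω : Type*} [mΩ : MeasurableSpace Ω] (P : Measure Ω)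

/-- The covariance function `K = E[(X - E X) ⊗ (X - E X)] ∈ L²(I²)` of `X`, that is,
`K(s,t) = Cov{X(s), X(t)}`. -/
def covFun (X : Ω → L2I) : L2I2 :=
  ∫ ω, tensor (X ω - ∫ ω', X ω' ∂P) (X ω - ∫ ω', X ω' ∂P) ∂P

/-- The principal component score `ξ_k = ∫ [X(t) - E{X(t)}] φ_k(t) dt`. -/
def score (X : Ω → L2I) (φ : HilbertBasis ℕ ℝ L2I) (k : ℕ) (ω : Ω) : ℝ :=
  ∫ t : I, (X ω - ∫ ω', X ω' ∂P : L2I) t * φ k t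

/-- The conditional expectation `E(Y ∣ X)` given the σ-field generated by `X`, an
`L²(I)`-valued random variable. -/
def condExpGiven (X Y : Ω → L2I) : Ω → L2I :=
  P[Y | MeasurableSpace.comap X inferInstance]

/-- The functional linear model
`E(Y ∣ X)(s) = E{Y(s)} + ∫ b(s,t) [X(t) - E{X(t)}] dt`, an almost sure equality of
`L²(I)`-valued random variables. -/
def FunctionalLinearModel (X Y : Ω → L2I) (b : L2I2) : Prop :=
  ∀ᵐ ω ∂P, ∀ᵐ s : I, condExpGiven P X Y ω s =
    (∫ ω', Y ω' ∂P : L2I) s + ∫ t : I, b (s, t) * (X ω - ∫ ω', X ω' ∂P : L2I) t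

/-- `E(‖𝓔‖² ∣ X)` for the error `𝓔 = Y - E(Y ∣ X)`. -/
def condErrorVar (X Y : Ω → L2I) : Ω → ℝ :=
  P[fun ω => ‖Y ω - condExpGiven P X Y ω‖ ^ 2 | MeasurableSpace.comap X inferInstance]

/-- `Z_n = O_P(a_n)`: for every `ε > 0` there is a constant `M` with
`P(|Z_n| > M a_n) ≤ ε` for all large `n`. -/
def IsBigOP (Z : ℕ → Ω → ℝ) (a : ℕ → ℝ) : Prop :=
  ∀ ε : ℝ, 0 < ε → ∃ M : ℝ, 0 < M ∧
    ∀ᶠ n in atTop, P {ω | M * a n < |Z n ω|} ≤ ENNReal.ofReal ε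

end Population

section Sample

/-- The sample mean `n⁻¹ ∑_{i ≤ n} x_i`. -/
def sampleMean (n : ℕ) (x : ℕ → L2I) : L2I :=
  (n : ℝ)⁻¹ • ∑ i ∈ Finset.range n, x i

/-- The empirical covariance function
`K̂(s,t) = n⁻¹ ∑_{i ≤ n} {x_i(s) - x̄(s)} {x_i(t) - x̄(t)}`. -/
def empCov (n : ℕ) (x : ℕ → L2I) : L2I2 :=
  (n : ℝ)⁻¹ • ∑ i ∈ Finset.range n, tensor (x i - sampleMean n x) (x i - sampleMean n x)

/-- The empirical score `ξ̂_{i,k} = ∫ {x_i(t) - x̄(t)} φ̂_k(t) dt`. -/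
def empScore (n : ℕ) (x : ℕ → L2I) (φ' : HilbertBasis ℕ ℝ L2I) (i k : ℕ) : ℝ :=
  ∫ t : I, (x i - sampleMean n x : L2I) t * φ' k t

/-- The single-truncation estimator
`b̂(s,t) = ∑_{k ≤ m} [n⁻¹ ∑_{i ≤ n} ξ̂_{i,k} y_i(s) / κ̂_k] φ̂_k(t)`, computed from the data
`(x_i, y_i)`, `i ≤ n`, and a spectral expansion `(κ̂, φ̂)` of the empirical covariance function. -/
def bHat (n m : ℕ) (x y : ℕ → L2I) (κ' : ℕ → ℝ) (φ' : HilbertBasis ℕ ℝ L2I) : L2I2 :=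
  ∑ k ∈ Finset.range m,
    tensor ((κ' k)⁻¹ • ((n : ℝ)⁻¹ • ∑ i ∈ Finset.range n, empScore n x φ' i k • y i)) (φ' k)

end Sample

end FunctionalRegression

end

open FunctionalRegression

noncomputable section

namespace FunctionalRegression

/-! Expand the error by Parseval in the empirical basis. Kernels act as operators through `op`;
write `Δ` for the empirical minus the true covariance, `g` for `κ (m-1) - κ m` and `ρ` for `κ
(m-1)`.

For `k < m` the signal is reproduced exactly, because `φ' k` is an eigenvector of the empirical
covariance, so only noise is left (`op_bHat_sub`). For `k ≥ m` the error is `-op b (φ' k)`.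

Noise: expectations cannot be taken directly, since `φ'` depends on the data. With `D = (K + ρ)⁻¹`
and `S` the average of `e_i ⊗ D (x_i - x̄)`, the noise component at `φ' k` is `S (K + ρ) φ' k = (κ'
k + ρ) S φ' k - S Δ φ' k`. If `‖Δ‖ ≤ ρ / 2`, the total is at most `20 ‖S‖²` (`norm_sq_bHat_sub_le`).
After centring at the population mean, the second moment is of order `n⁻¹ ∑ κ_k / (κ_k + ρ)²`, which
is `O(n⁻¹ m^(α+1))` (`tsum_eigenvalue_div_sq_le`).

Tail: `b` cut off at the true `φ 0, …, φ (m-1)` leaves a bias of order `m^(1-2β)`. The kept part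
meets the empirical tail only through the residuals of `φ k`, bounded by `‖Δ φ_k‖ / (κ_k - κ' m)`
(`norm_residual_mul_le`). As `E ‖Δ φ_k‖²` is of order `κ_k / n`, a weighted Cauchy–Schwarz
inequality bounds this contribution by `n⁻¹` times the square of `perturbationWeight`, which stays
bounded because `β > α / 2 + 1` (`exists_perturbationWeight_le`). Individual empirical
eigenfunctions need not be consistent at any rate.

All this holds on an event where `‖Δ‖ ≤ g / 2`. Its probability tends to one because `n g² → ∞`,
which is what `m = o(n^(1/(2α+2)))` provides. The exponent `γ` enters only through the convergence
of `∑ j^(-2γ)`. -/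

/-! ### Rank-one kernels and integral operators -/

theorem coeFn_tensor (f g : L2I) :
    tensor f g =ᵐ[(volume : Measure (I × I))] fun p => f p.1 * g p.2 :=
  MemLp.coeFn_toLp _

theorem inner_L2I (f g : L2I) : inner ℝ f g = ∫ t : I, f t * g t := by
  rw [L2.inner_def]
  refine integral_congr_ae (Eventually.of_forall fun t => ?_)
  simp [mul_comm]

theorem inner_tensor_right (R : L2I2) (f g : L2I) :
    inner ℝ R (tensor f g) = ∫ p : I × I, R p * (f p.1 * g p.2) := by
  rw [L2.inner_def]
  refine integral_congr_ae ?_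
  filter_upwards [coeFn_tensor f g] with p hp
  simp [hp, mul_comm]

theorem inner_tensor_tensor (f g f' g' : L2I) :
    inner ℝ (tensor f g) (tensor f' g') = inner ℝ f f' * inner ℝ g g' := by
  rw [inner_tensor_right, inner_L2I, inner_L2I, ← integral_prod_mul]
  refine integral_congr_ae ?_
  filter_upwards [coeFn_tensor f g] with p hp
  rw [hp]; ring

theorem norm_tensor (f g : L2I) : ‖tensor f g‖ = ‖f‖ * ‖g‖ := by
  have h := inner_tensor_tensor f g f g
  simp only [real_inner_self_eq_norm_sq] at h
  rw [← mul_pow] at h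
  exact (pow_left_inj₀ (norm_nonneg _) (by positivity) two_ne_zero).1 h

theorem tensor_add_left (f f' g : L2I) : tensor (f + f') g = tensor f g + tensor f' g := by
  rw [← sub_eq_zero, ← inner_self_eq_zero (𝕜 := ℝ)]
  simp only [inner_sub_left, inner_sub_right, inner_add_left, inner_add_right, inner_tensor_tensor]
  ring

theorem tensor_add_right (f g g' : L2I) : tensor f (g + g') = tensor f g + tensor f g' := by
  rw [← sub_eq_zero, ← inner_self_eq_zero (𝕜 := ℝ)]
  simp only [inner_sub_left, inner_sub_right, inner_add_left, inner_add_right, inner_tensor_tensor]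
  ring

theorem tensor_smul_left (c : ℝ) (f g : L2I) : tensor (c • f) g = c • tensor f g := by
  rw [← sub_eq_zero, ← inner_self_eq_zero (𝕜 := ℝ)]
  simp only [inner_sub_left, inner_sub_right, real_inner_smul_left, real_inner_smul_right,
    inner_tensor_tensor]
  ring

theorem tensor_smul_right (c : ℝ) (f g : L2I) : tensor f (c • g) = c • tensor f g := by
  rw [← sub_eq_zero, ← inner_self_eq_zero (𝕜 := ℝ)]
  simp only [inner_sub_left, inner_sub_right, real_inner_smul_left, real_inner_smul_right,
    inner_tensor_tensor]
  ring

/-- `tensor` as a continuous bilinear map. -/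
def tensorL : L2I →L[ℝ] L2I →L[ℝ] L2I2 :=
  LinearMap.mkContinuous₂ (LinearMap.mk₂ ℝ tensor tensor_add_left tensor_smul_left
    tensor_add_right tensor_smul_right) 1 fun f g => by
      simp [norm_tensor]

@[simp] theorem tensorL_apply (f g : L2I) : tensorL f g = tensor f g := rfl

theorem continuous_tensor : Continuous fun p : L2I × L2I => tensor p.1 p.2 :=
  tensorL.continuous₂

theorem tensor_sub_left (f f' g : L2I) : tensor (f - f') g = tensor f g - tensor f' g := by
  exact congrArg (fun T : L2I →L[ℝ] L2I2 => T g) (map_sub tensorL f f')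

theorem tensor_sub_right (f g g' : L2I) : tensor f (g - g') = tensor f g - tensor f g' := by
  simpa using map_sub (tensorL f) g g'

theorem tensor_sum_left {ι : Type*} (s : Finset ι) (f : ι → L2I) (g : L2I) :
    tensor (∑ i ∈ s, f i) g = ∑ i ∈ s, tensor (f i) g := by
  rw [← tensorL_apply, map_sum, _root_.sum_apply]
  rfl

theorem tensor_sum_right {ι : Type*} (s : Finset ι) (f : L2I) (g : ι → L2I) :
    tensor f (∑ i ∈ s, g i) = ∑ i ∈ s, tensor f (g i) := by
  exact map_sum (tensorL f) g s

theorem norm_adjoint_tensorL_flip_le (R : L2I2) (h : L2I) :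
    ‖ContinuousLinearMap.adjoint (tensorL.flip h) R‖ ≤ ‖R‖ * ‖h‖ := by
  have h1 : ‖ContinuousLinearMap.adjoint (tensorL.flip h)‖ ≤ ‖h‖ := by
    rw [LinearIsometryEquiv.norm_map]
    refine ContinuousLinearMap.opNorm_le_bound _ (norm_nonneg _) fun f => ?_
    simp [norm_tensor, mul_comm]
  calc _ ≤ ‖ContinuousLinearMap.adjoint (tensorL.flip h)‖ * ‖R‖ :=
        ContinuousLinearMap.le_opNorm _ _
    _ ≤ ‖h‖ * ‖R‖ := by gcongr
    _ = _ := mul_comm _ _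

/-- The integral operator `h ↦ ∫ R(·,t) h(t) dt` with kernel `R`, as a continuous linear
function of `R` and `h`. -/
def op : L2I2 →L[ℝ] L2I →L[ℝ] L2I :=
  LinearMap.mkContinuous₂
    (LinearMap.mk₂ ℝ (fun R h => ContinuousLinearMap.adjoint (tensorL.flip h) R)
      (fun _ _ _ => map_add _ _ _) (fun _ _ _ => map_smul _ _ _)
      (fun R h h' => by simp) (fun c R h => by simp)) 1 fun R h => by
        simpa using norm_adjoint_tensorL_flip_le R h

theorem inner_op_left (R : L2I2) (h f : L2I) : inner ℝ (op R h) f = inner ℝ R (tensor f h) := by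
  change inner ℝ (ContinuousLinearMap.adjoint (tensorL.flip h) R) f = _
  rw [ContinuousLinearMap.adjoint_inner_left]
  rfl

theorem norm_op_le (R : L2I2) (h : L2I) : ‖op R h‖ ≤ ‖R‖ * ‖h‖ :=
  norm_adjoint_tensorL_flip_le R h

theorem op_tensor (f g h : L2I) : op (tensor f g) h = (inner ℝ g h : ℝ) • f := by
  refine ext_inner_right ℝ fun v => ?_
  rw [inner_op_left, inner_tensor_tensor, real_inner_smul_left, mul_comm]

/-- `op` is built by duality; this links it to the pointwise integral in which the regression model
is stated. Cauchy–Schwarz on almost every section puts the integral in `L²`, and Fubini identifies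
the two by testing against `f`. -/
theorem op_ae_eq (R : L2I2) (h : L2I) : op R h =ᵐ[volume] fun s : I => ∫ t : I, R (s, t) * h t := by
  have hR := Lp.memLp R
  have hh := Lp.memLp h
  have hRm : AEStronglyMeasurable (fun p : I × I => R p) (volume.prod volume) := hR.1
  have hm : AEStronglyMeasurable (fun p : I × I => R p * h p.2) (volume.prod volume) :=
    hRm.mul hh.1.comp_snd
  have hRsq : Integrable (fun p : I × I => R p ^ 2) (volume.prod volume) := hR.integrable_sq
  have hsec : ∀ᵐ s : I, MemLp (fun t => R (s, t)) 2 volume := by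
    filter_upwards [hRsq.prod_right_ae, hRm.prodMk_left] with s h1 h2
    exact (memLp_two_iff_integrable_sq h2).2 h1
  have hgm : AEStronglyMeasurable (fun s : I => ∫ t : I, R (s, t) * h t) volume :=
    hm.integral_prod_right'
  have hg : MemLp (fun s : I => ∫ t : I, R (s, t) * h t) 2 volume := by
    rw [memLp_two_iff_integrable_sq hgm]
    refine Integrable.mono' ((hRsq.integral_prod_left).mul_const (‖h‖ ^ 2)) (hgm.pow 2) ?_
    filter_upwards [hsec] with s hs
    have e1 : ∫ t : I, R (s, t) * h t = inner ℝ (hs.toLp _) h := by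
      rw [inner_L2I]
      refine integral_congr_ae ?_
      filter_upwards [hs.coeFn_toLp] with t ht
      rw [ht]
    have e2 : ∫ t : I, R (s, t) ^ 2 = ‖hs.toLp _‖ ^ 2 := by
      rw [← real_inner_self_eq_norm_sq, inner_L2I]
      refine integral_congr_ae ?_
      filter_upwards [hs.coeFn_toLp] with t ht
      rw [ht, sq]
    rw [e1, e2, Real.norm_eq_abs, abs_pow, ← mul_pow]
    gcongr
    exact abs_real_inner_le_norm _ _
  have key : op R h = hg.toLp _ := by
    refine ext_inner_right ℝ fun f => ?_
    rw [inner_op_left, inner_tensor_right, inner_L2I]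
    have hint : Integrable (fun p : I × I => R p * (f p.1 * h p.2)) (volume.prod volume) := by
      have := hR.integrable_mul (memLp_tensor f h)
      exact this
    rw [show (∫ p : I × I, R p * (f p.1 * h p.2)) =
      ∫ p, R p * (f p.1 * h p.2) ∂((volume : Measure I).prod volume) from rfl, integral_prod _ hint]
    refine integral_congr_ae ?_
    filter_upwards [hg.coeFn_toLp] with s hs
    rw [hs, ← integral_mul_const]
    congr 1; ext t; ring
  rw [key]
  exact hg.coeFn_toLp

/-! ### Completeness of product bases and Parseval for kernels -/

/-- Countability of the basis gives one null set of `s` outside which the section `R (s, ·)` is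
orthogonal to every `e k`, hence zero; Fubini concludes. -/
theorem eq_zero_of_op_eq_zero {ι : Type*} [Countable ι] (e : HilbertBasis ι ℝ L2I) (R : L2I2)
    (h : ∀ k, op R (e k) = 0) : R = 0 := by
  have hR := Lp.memLp R
  have hRm : AEStronglyMeasurable (fun p : I × I => R p) (volume.prod volume) := hR.1
  have hRsq : Integrable (fun p : I × I => R p ^ 2) (volume.prod volume) := hR.integrable_sq
  have h0 : ∀ᵐ s : I, ∀ k, ∫ t : I, R (s, t) * e k t = 0 := by
    rw [ae_all_iff]
    intro k
    have h1 := op_ae_eq R (e k)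
    rw [h k] at h1
    filter_upwards [h1, Lp.coeFn_zero ℝ 2 (volume : Measure I)] with s h2 h3
    rw [← h2, h3]; rfl
  have h1 : ∀ᵐ s : I, ∀ᵐ t : I, R (s, t) = 0 := by
    filter_upwards [hRsq.prod_right_ae, hRm.prodMk_left, h0] with s h1 h2 h3
    have hs : MemLp (fun t => R (s, t)) 2 volume := (memLp_two_iff_integrable_sq h2).2 h1
    have hz : hs.toLp _ = 0 := by
      refine e.repr.injective ?_
      ext k
      rw [map_zero, e.repr_apply_apply, real_inner_comm, inner_L2I]
      refine Eq.trans (integral_congr_ae ?_) (h3 k)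
      filter_upwards [hs.coeFn_toLp] with t ht
      rw [ht]
    filter_upwards [hs.coeFn_toLp, Lp.coeFn_zero ℝ 2 (volume : Measure I)] with t h4 h5
    rw [← h4, hz, h5]; rfl
  refine Lp.ext ?_
  have hms : MeasurableSet {p : I × I | R p = 0} :=
    (Lp.stronglyMeasurable R).measurable (measurableSet_singleton 0)
  have : ∀ᵐ p ∂((volume : Measure I).prod volume), R p = 0 :=
    (Measure.ae_prod_iff_ae_ae hms).2 h1
  filter_upwards [show ∀ᵐ p : I × I, R p = 0 from this,
    Lp.coeFn_zero ℝ 2 (volume : Measure (I × I))] with p h2 h3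
  rw [h2, h3]; rfl

theorem hasSum_inner_sq {ι H : Type*} [NormedAddCommGroup H] [InnerProductSpace ℝ H]
    (e : HilbertBasis ι ℝ H) (x : H) : HasSum (fun k => inner ℝ (e k) x ^ 2) (‖x‖ ^ 2) := by
  have h := e.hasSum_inner_mul_inner x x
  rw [real_inner_self_eq_norm_sq] at h
  refine h.congr_fun fun k => ?_
  rw [real_inner_comm, sq]

theorem orthonormal_tensor {ι : Type*} (e : HilbertBasis ι ℝ L2I) :
    Orthonormal ℝ fun p : ι × ι => tensor (e p.2) (e p.1) := by
  classical
  have h := orthonormal_iff_ite.1 e.orthonormal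
  rw [orthonormal_iff_ite]
  rintro ⟨i, j⟩ ⟨i', j'⟩
  rw [inner_tensor_tensor, h, h]
  by_cases h1 : i = i' <;> by_cases h2 : j = j' <;> simp [h1, h2]

/-- Parseval's identity for kernels. -/
theorem hasSum_norm_op_sq {ι : Type*} [Countable ι] (e : HilbertBasis ι ℝ L2I) (R : L2I2) :
    HasSum (fun k => ‖op R (e k)‖ ^ 2) (‖R‖ ^ 2) := by
  have hbot : (Submodule.span ℝ (Set.range fun p : ι × ι => tensor (e p.2) (e p.1)))ᗮ = ⊥ := by
    rw [Submodule.eq_bot_iff]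
    intro S hS
    refine eq_zero_of_op_eq_zero e S fun k => ?_
    refine e.repr.injective ?_
    ext j
    rw [map_zero, e.repr_apply_apply, real_inner_comm, inner_op_left]
    exact (Submodule.mem_orthogonal' _ _).1 hS _ (Submodule.subset_span ⟨(k, j), rfl⟩)
  let E := HilbertBasis.mkOfOrthogonalEqBot (orthonormal_tensor e) hbot
  have hE := hasSum_inner_sq E R
  -- The pair `(k, j)` indexes `e j ⊗ e k`, so the fibre over `k` is the expansion of `op R (e k)`.
  refine hE.prod_fiberwise fun k => ?_
  have h2 := hasSum_inner_sq e (op R (e k))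
  refine h2.congr_fun fun j => ?_
  rw [real_inner_comm (op R (e k)), inner_op_left, real_inner_comm]
  simp [E]

theorem coef_eq_inner (φ : HilbertBasis ℕ ℝ L2I) (b : L2I2) (j k : ℕ) :
    coef φ b j k = inner ℝ (φ j) (op b (φ k)) := by
  rw [real_inner_comm, inner_op_left, inner_tensor_right, coef]

/-! ### Spectral expansions: eigenvalue perturbation and resolvent -/

namespace IsSpectralExpansion

variable {R : L2I2} {κ : ℕ → ℝ} {φ : HilbertBasis ℕ ℝ L2I}

/-- A continuous linear functional of `R` may be applied to the series term by term, and
orthonormality leaves a single term. -/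
theorem inner_op (h : IsSpectralExpansion R κ φ) (k : ℕ) (x : L2I) :
    inner ℝ (φ k) (op R x) = κ k * inner ℝ (φ k) x := by
  have h1 := (h.hasSum.mapL (op.flip x)).mapL (innerSL ℝ (φ k))
  have h2 : HasSum (fun j => (innerSL ℝ (φ k)) ((op.flip x) (κ j • tensor (φ j) (φ j))))
      (κ k * inner ℝ (φ k) x) := by
    convert hasSum_single k ?_ using 1
    · simp [op_tensor, φ.orthonormal.1]
    · intro j hj
      simp [op_tensor, φ.orthonormal.2 hj.symm]
  exact h1.unique h2

theorem op_apply (h : IsSpectralExpansion R κ φ) (k : ℕ) : op R (φ k) = κ k • φ k := by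
  refine φ.repr.injective ?_
  ext j
  rw [φ.repr_apply_apply, φ.repr_apply_apply, h.inner_op, real_inner_smul_right]
  rcases eq_or_ne j k with rfl | hjk
  · rfl
  · simp [φ.orthonormal.2 hjk]

end IsSpectralExpansion

theorem norm_add_sq_le_two_mul {H : Type*} [SeminormedAddCommGroup H] (x y : H) :
    ‖x + y‖ ^ 2 ≤ 2 * ‖x‖ ^ 2 + 2 * ‖y‖ ^ 2 := by
  nlinarith [norm_add_le x y, norm_nonneg (x + y), norm_nonneg x, norm_nonneg y,
    sq_nonneg (‖x‖ - ‖y‖)]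

theorem norm_sub_sq_le_two_mul {H : Type*} [SeminormedAddCommGroup H] (x y : H) :
    ‖x - y‖ ^ 2 ≤ 2 * ‖x‖ ^ 2 + 2 * ‖y‖ ^ 2 := by
  simpa [sub_eq_add_neg] using norm_add_sq_le_two_mul x (-y)

namespace IsSpectralExpansion

variable {K K' : L2I2} {κ κ' : ℕ → ℝ} {φ φ' : HilbertBasis ℕ ℝ L2I}

theorem hasSum_inner_op (hK : IsSpectralExpansion K κ φ) (x : L2I) :
    HasSum (fun k => κ k * inner ℝ (φ k) x ^ 2) (inner ℝ (op K x) x) := by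
  refine (φ.hasSum_inner_mul_inner (op K x) x).congr_fun fun k => ?_
  rw [real_inner_comm (φ k), hK.inner_op, real_inner_comm x]
  ring

/-- Weyl's inequality. -/
theorem eigenvalue_le (hK : IsSpectralExpansion K κ φ) (hK' : IsSpectralExpansion K' κ' φ')
    (m : ℕ) : κ' m ≤ κ m + ‖K' - K‖ := by
  -- Orthogonality to `φ 0, …, φ (m-1)` is `m` conditions on the `(m+1)`-dimensional span of `φ' 0,
  -- …, φ' m`. A non-zero solution `v` has quadratic form at most `κ m` for `K` and at least `κ' m`
  -- for `K'`, relative to `‖v‖²`.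
  let T : (Fin (m + 1) → ℝ) →ₗ[ℝ] (Fin m → ℝ) :=
    { toFun := fun c j => inner ℝ (φ j) (∑ k, c k • φ' k)
      map_add' := fun c d => by
        ext j; simp [add_smul, Finset.sum_add_distrib, inner_add_right]
      map_smul' := fun r c => by
        ext j
        simp only [Pi.smul_apply, smul_eq_mul, RingHom.id_apply, ← smul_smul, ← Finset.smul_sum,
          real_inner_smul_right] }
  have hker : LinearMap.ker T ≠ ⊥ := LinearMap.ker_ne_bot_of_finrank_lt (by simp)
  obtain ⟨c, hc, hc0⟩ := (Submodule.ne_bot_iff _).1 hker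
  set v : L2I := ∑ k, c k • φ' k with hv
  have hvφ : ∀ j < m, inner ℝ (φ j) v = 0 := fun j hj =>
    congrFun (LinearMap.mem_ker.1 hc) ⟨j, hj⟩
  have hvφ' : ∀ j, m < j → inner ℝ (φ' j) v = 0 := by
    intro j hj
    rw [hv, inner_sum]
    refine Finset.sum_eq_zero fun k _ => ?_
    rw [real_inner_smul_right, φ'.orthonormal.2 (by omega), mul_zero]
  have hvpos : 0 < ‖v‖ ^ 2 := by
    have : v ≠ 0 := by
      intro h0
      have hli := (φ'.orthonormal.linearIndependent.comp (fun k : Fin (m + 1) => (k : ℕ))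
        Fin.val_injective)
      exact hc0 (funext (Fintype.linearIndependent_iff.1 hli c h0))
    positivity
  have h1 : inner ℝ (op K v) v ≤ κ m * ‖v‖ ^ 2 := by
    refine hasSum_le (fun k => ?_) (hK.hasSum_inner_op v) ((hasSum_inner_sq φ v).mul_left (κ m))
    rcases lt_or_ge k m with hk | hk
    · simp [hvφ k hk]
    · exact mul_le_mul_of_nonneg_right (hK.antitone hk) (sq_nonneg _)
  have h2 : κ' m * ‖v‖ ^ 2 ≤ inner ℝ (op K' v) v := by
    refine hasSum_le (fun k => ?_) ((hasSum_inner_sq φ' v).mul_left (κ' m))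
      (hK'.hasSum_inner_op v)
    rcases lt_or_ge m k with hk | hk
    · simp [hvφ' k hk]
    · exact mul_le_mul_of_nonneg_right (hK'.antitone hk) (sq_nonneg _)
  have h3 : inner ℝ (op K' v) v - inner ℝ (op K v) v ≤ ‖K' - K‖ * ‖v‖ ^ 2 := by
    rw [← inner_sub_left, ← _root_.sub_apply, ← map_sub]
    calc _ ≤ ‖op (K' - K) v‖ * ‖v‖ := real_inner_le_norm _ _
      _ ≤ (‖K' - K‖ * ‖v‖) * ‖v‖ := by gcongr; exact norm_op_le _ _
      _ = _ := by ring
  have h4 : κ' m * ‖v‖ ^ 2 ≤ (κ m + ‖K' - K‖) * ‖v‖ ^ 2 := by linarith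
  exact le_of_mul_le_mul_right h4 hvpos

/-- The regularized inverse `(K + ρ)⁻¹`. -/
theorem exists_resolvent (hK : IsSpectralExpansion K κ φ) {ρ : ℝ} (hρ : 0 < ρ) :
    ∃ D : L2I →L[ℝ] L2I, ∀ k x, inner ℝ (φ k) (D x) = (κ k + ρ)⁻¹ * inner ℝ (φ k) x := by
  let A : L2I →L[ℝ] L2I := op K + ρ • ContinuousLinearMap.id ℝ L2I
  have hAx : ∀ x, A x = op K x + ρ • x := fun x => rfl
  have hA : IsUnit A := by
    -- Since `K` is positive, the quadratic form of `K + ρ` dominates `ρ ‖x‖²`; coercivity gives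
    -- invertibility.
    refine ContinuousLinearMap.isUnit_of_forall_le_norm_inner_map A (c := ⟨ρ, hρ.le⟩) hρ fun x => ?_
    have h0 : 0 ≤ inner ℝ (op K x) x :=
      (hK.hasSum_inner_op x).nonneg fun k => mul_nonneg (hK.nonneg k) (sq_nonneg _)
    refine le_trans ?_ (le_abs_self _)
    rw [hAx, inner_add_left, real_inner_smul_left, real_inner_self_eq_norm_sq]
    change ‖x‖ ^ 2 * ρ ≤ _
    linarith
  obtain ⟨u, hu⟩ := hA
  refine ⟨(↑u⁻¹ : L2I →L[ℝ] L2I), fun k x => ?_⟩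
  have hx : A ((↑u⁻¹ : L2I →L[ℝ] L2I) x) = x := by
    rw [← hu, ← mul_apply_eq_comp, Units.mul_inv]
    rfl
  have hpos : κ k + ρ ≠ 0 := by have := hK.nonneg k; positivity
  conv_rhs => rw [← hx, hAx, inner_add_right, hK.inner_op, real_inner_smul_right]
  field_simp

/-- The factors `(κ k + ρ)⁻¹` and `κ k + ρ` cancel in coordinates. This inserts `D` on the data side
at the price of `K + ρ` on the vector tested against. -/
theorem inner_resolvent (hK : IsSpectralExpansion K κ φ) {ρ : ℝ} (hρ : 0 < ρ) {D : L2I →L[ℝ] L2I}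
    (hD : ∀ k x, inner ℝ (φ k) (D x) = (κ k + ρ)⁻¹ * inner ℝ (φ k) x) (c h : L2I) :
    inner ℝ (D c) (op K h + ρ • h) = inner ℝ c h := by
  refine (φ.hasSum_inner_mul_inner _ _).unique
    ((φ.hasSum_inner_mul_inner c h).congr_fun fun k => ?_)
  have hpos : κ k + ρ ≠ 0 := by have := hK.nonneg k; positivity
  rw [real_inner_comm, hD, inner_add_right, hK.inner_op, real_inner_smul_right,
    real_inner_comm (φ k) c]
  field_simp

end IsSpectralExpansion

/-! ### Residuals of eigenvectors and the tail of the slope -/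

/-- The component of `x` orthogonal to the first `m` basis vectors. -/
def residual (φ : HilbertBasis ℕ ℝ L2I) (m : ℕ) (x : L2I) : L2I :=
  x - ∑ l ∈ Finset.range m, (inner ℝ (φ l) x : ℝ) • φ l

theorem inner_residual (φ : HilbertBasis ℕ ℝ L2I) (m : ℕ) (x : L2I) (l : ℕ) :
    inner ℝ (φ l) (residual φ m x) = if l < m then 0 else inner ℝ (φ l) x := by
  have h := orthonormal_iff_ite.1 φ.orthonormal
  simp only [residual, inner_sub_right, inner_sum, real_inner_smul_right, h, mul_ite, mul_one,
    mul_zero, Finset.sum_ite_eq, Finset.mem_range]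
  split_ifs <;> simp

/-- An eigenvector of `K` is nearly orthogonal to the eigenvectors of `K'` that belong to the
small eigenvalues. -/
theorem norm_residual_mul_le {K K' : L2I2} {κ κ' : ℕ → ℝ} {φ φ' : HilbertBasis ℕ ℝ L2I}
    (hK : IsSpectralExpansion K κ φ) (hK' : IsSpectralExpansion K' κ' φ') {k m : ℕ}
    (hkm : κ' m ≤ κ k) :
    ‖residual φ' m (φ k)‖ * (κ k - κ' m) ≤ ‖op (K' - K) (φ k)‖ := by
  have h0 : 0 ≤ κ k - κ' m := sub_nonneg.2 hkm
  refine (pow_le_pow_iff_left₀ (by positivity) (norm_nonneg _) two_ne_zero).1 ?_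
  rw [mul_pow]
  refine hasSum_le (fun l => ?_) ((hasSum_inner_sq φ' (residual φ' m (φ k))).mul_right
    ((κ k - κ' m) ^ 2)) (hasSum_inner_sq φ' (op (K' - K) (φ k)))
  rw [inner_residual]
  split_ifs with hl
  · simpa using sq_nonneg _
  -- Coordinate `l ≥ m` of `(K' - K) φ_k` is `(κ' l - κ k)` times that of `φ_k`, and `κ' l ≤ κ' m ≤
  -- κ k`.
  · rw [map_sub, _root_.sub_apply, inner_sub_right, hK'.inner_op, hK.op_apply,
      real_inner_smul_right]
    have h1 : κ' l ≤ κ' m := hK'.antitone (not_lt.1 hl)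
    have h2 : (κ k - κ' m) ^ 2 ≤ (κ k - κ' l) ^ 2 := by gcongr
    nlinarith [sq_nonneg (inner ℝ (φ' l) (φ k))]

/-- The kernel `b` restricted to the first `m` basis functions in its second argument. -/
def truncKernel (φ : HilbertBasis ℕ ℝ L2I) (b : L2I2) (m : ℕ) : L2I2 :=
  ∑ k ∈ Finset.range m, tensor (op b (φ k)) (φ k)

theorem op_sum_tensor {ι : Type*} (s : Finset ι) (f g : ι → L2I) (h : L2I) :
    op (∑ i ∈ s, tensor (f i) (g i)) h = ∑ i ∈ s, (inner ℝ (g i) h : ℝ) • f i := by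
  rw [map_sum, _root_.sum_apply]
  simp only [op_tensor]

theorem hasSum_norm_sub_truncKernel (φ : HilbertBasis ℕ ℝ L2I) (b : L2I2) (m : ℕ) :
    HasSum (fun k => ‖op b (φ (k + m))‖ ^ 2) (‖b - truncKernel φ b m‖ ^ 2) := by
  have h1 : ∀ k, op (b - truncKernel φ b m) (φ k) = if k < m then 0 else op b (φ k) := by
    intro k
    have h := orthonormal_iff_ite.1 φ.orthonormal
    rw [map_sub, _root_.sub_apply, truncKernel, op_sum_tensor]
    simp only [h, ite_smul, one_smul, zero_smul, Finset.sum_ite_eq', Finset.mem_range]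
    split_ifs <;> simp
  have h2 := (hasSum_nat_add_iff' m).2 (hasSum_norm_op_sq φ (b - truncKernel φ b m))
  have h3 : ∑ i ∈ Finset.range m, ‖op (b - truncKernel φ b m) (φ i)‖ ^ 2 = 0 :=
    Finset.sum_eq_zero fun i hi => by rw [h1, if_pos (Finset.mem_range.1 hi)]; simp
  rw [h3, sub_zero] at h2
  refine h2.congr_fun fun k => ?_
  rw [h1, if_neg (by omega)]

/-- Against `φ' l` with `l ≥ m`, a vector and its residual have the same inner product. So the
truncated kernel can be replaced there by `Q`, whose norm is small when the residuals are. -/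
theorem tsum_norm_op_tail_le (φ φ' : HilbertBasis ℕ ℝ L2I) (b : L2I2) (m : ℕ) :
    ∑' l, ‖op b (φ' (l + m))‖ ^ 2 ≤ 2 * ‖b - truncKernel φ b m‖ ^ 2 +
      2 * (∑ k ∈ Finset.range m, ‖op b (φ k)‖ * ‖residual φ' m (φ k)‖) ^ 2 := by
  set Q : L2I2 := ∑ k ∈ Finset.range m, tensor (op b (φ k)) (residual φ' m (φ k)) with hQ
  have hQn : ‖Q‖ ≤ ∑ k ∈ Finset.range m, ‖op b (φ k)‖ * ‖residual φ' m (φ k)‖ :=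
    (norm_sum_le _ _).trans_eq (by simp only [norm_tensor])
  have heq : ∀ l, op b (φ' (l + m)) = op (b - truncKernel φ b m + Q) (φ' (l + m)) := by
    intro l
    rw [map_add op, map_sub op, _root_.add_apply, _root_.sub_apply, hQ, truncKernel, op_sum_tensor, op_sum_tensor]
    have : ∀ k, (inner ℝ (residual φ' m (φ k)) (φ' (l + m)) : ℝ) = inner ℝ (φ k) (φ' (l + m)) := by
      intro k
      rw [real_inner_comm, inner_residual, if_neg (by omega), real_inner_comm]
    simp only [this]
    abel
  have hs := hasSum_norm_op_sq φ' (b - truncKernel φ b m + Q)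
  have hle : ∑' l, ‖op b (φ' (l + m))‖ ^ 2 ≤ ‖b - truncKernel φ b m + Q‖ ^ 2 := by
    simp only [heq]
    rw [← hs.tsum_eq, ← hs.summable.sum_add_tsum_nat_add m]
    exact le_add_of_nonneg_left (Finset.sum_nonneg fun _ _ => sq_nonneg _)
  refine hle.trans ((norm_add_sq_le_two_mul _ _).trans ?_)
  gcongr

/-! ### Algebra of the estimator -/

theorem empScore_eq_inner (n : ℕ) (x : ℕ → L2I) (φ' : HilbertBasis ℕ ℝ L2I) (i k : ℕ) :
    empScore n x φ' i k = inner ℝ (x i - sampleMean n x) (φ' k) :=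
  (inner_L2I _ _).symm

theorem sum_sub_sampleMean {n : ℕ} (hn : n ≠ 0) (x : ℕ → L2I) :
    ∑ i ∈ Finset.range n, (x i - sampleMean n x) = 0 := by
  rw [Finset.sum_sub_distrib, Finset.sum_const, Finset.card_range, sampleMean,
    ← Nat.cast_smul_eq_nsmul ℝ, smul_smul, mul_inv_cancel₀ (by exact_mod_cast hn), one_smul, sub_self]

theorem op_empCov (n : ℕ) (x : ℕ → L2I) (h : L2I) :
    op (empCov n x) h = (n : ℝ)⁻¹ • ∑ i ∈ Finset.range n,
      (inner ℝ (x i - sampleMean n x) h : ℝ) • (x i - sampleMean n x) := by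
  rw [empCov, map_smul, _root_.smul_apply, op_sum_tensor]

theorem op_bHat (n m : ℕ) (x y : ℕ → L2I) (κ' : ℕ → ℝ) (φ' : HilbertBasis ℕ ℝ L2I) (k : ℕ) :
    op (bHat n m x y κ' φ') (φ' k) = if k < m then (κ' k)⁻¹ • ((n : ℝ)⁻¹ •
      ∑ i ∈ Finset.range n, (inner ℝ (x i - sampleMean n x) (φ' k) : ℝ) • y i) else 0 := by
  have h := orthonormal_iff_ite.1 φ'.orthonormal
  rw [bHat, op_sum_tensor]
  simp only [h, ite_smul, one_smul, zero_smul, Finset.sum_ite_eq', Finset.mem_range,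
    empScore_eq_inner]

/-- For a component with non-zero empirical eigenvalue, the estimation error is due to the
noise only. -/
theorem op_bHat_sub {n m : ℕ} (hn : n ≠ 0) {x y e : ℕ → L2I} {a : L2I} {b : L2I2} {κ' : ℕ → ℝ}
    {φ' : HilbertBasis ℕ ℝ L2I} (hK' : IsSpectralExpansion (empCov n x) κ' φ')
    (hy : ∀ i, y i = a + op b (x i - sampleMean n x) + e i) {k : ℕ} (hk : k < m)
    (h0 : κ' k ≠ 0) :
    op (bHat n m x y κ' φ' - b) (φ' k) = (κ' k)⁻¹ • ((n : ℝ)⁻¹ •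
      ∑ i ∈ Finset.range n, (inner ℝ (x i - sampleMean n x) (φ' k) : ℝ) • e i) := by
  have h1 : ∑ i ∈ Finset.range n, (inner ℝ (x i - sampleMean n x) (φ' k) : ℝ) • a = 0 := by
    rw [← Finset.sum_smul, ← sum_inner, sum_sub_sampleMean hn, inner_zero_left, zero_smul]
  -- The signal part is `b` applied to the empirical covariance at `φ' k`; dividing by `κ' k` gives
  -- exactly `op b (φ' k)`, which cancels.
  have h2 : (n : ℝ)⁻¹ • ∑ i ∈ Finset.range n, (inner ℝ (x i - sampleMean n x) (φ' k) : ℝ) •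
      op b (x i - sampleMean n x) = κ' k • op b (φ' k) := by
    rw [← map_smul (op b), ← hK'.op_apply, op_empCov, map_smul, map_sum]
    simp only [map_smul]
  rw [map_sub, _root_.sub_apply, op_bHat, if_pos hk]
  simp only [hy, smul_add, Finset.sum_add_distrib, h1, h2, zero_add]
  rw [smul_smul, inv_mul_cancel₀ h0, one_smul]
  abel

/-- The tensor average on the right does not involve `φ'`, so its moments are accessible. Weyl's
inequality gives `κ' k ≥ ρ / 2` for `k < m`, so no empirical eigenvalue in use vanishes and `(κ' k +
ρ) / κ' k ≤ 3`. -/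
theorem norm_sq_bHat_sub_le {n m : ℕ} (hn : n ≠ 0) {x y e : ℕ → L2I} {a : L2I} {b K : L2I2}
    {κ κ' : ℕ → ℝ} {φ φ' : HilbertBasis ℕ ℝ L2I} (hK : IsSpectralExpansion K κ φ)
    (hK' : IsSpectralExpansion (empCov n x) κ' φ')
    (hy : ∀ i, y i = a + op b (x i - sampleMean n x) + e i) {ρ : ℝ} (hρ : 0 < ρ)
    (hρκ : ∀ k < m, ρ ≤ κ k) (hΔ : ‖empCov n x - K‖ ≤ ρ / 2) {D : L2I →L[ℝ] L2I}
    (hD : ∀ k x, inner ℝ (φ k) (D x) = (κ k + ρ)⁻¹ * inner ℝ (φ k) x) :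
    ‖bHat n m x y κ' φ' - b‖ ^ 2 ≤
      20 * ‖(n : ℝ)⁻¹ • ∑ i ∈ Finset.range n, tensor (e i) (D (x i - sampleMean n x))‖ ^ 2 +
      ∑' l, ‖op b (φ' (l + m))‖ ^ 2 := by
  set S : L2I2 := (n : ℝ)⁻¹ • ∑ i ∈ Finset.range n, tensor (e i) (D (x i - sampleMean n x)) with hS
  set Δ : L2I2 := empCov n x - K with hΔd
  have hκ' : ∀ k < m, ρ / 2 ≤ κ' k := by
    intro k hk
    have h1 := hK'.eigenvalue_le hK k
    rw [norm_sub_rev] at h1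
    linarith [hρκ k hk]
  have hterm : ∀ k < m, ‖op (bHat n m x y κ' φ' - b) (φ' k)‖ ^ 2 ≤
      18 * ‖op S (φ' k)‖ ^ 2 + 8 / ρ ^ 2 * ‖S‖ ^ 2 * ‖op Δ (φ' k)‖ ^ 2 := by
    intro k hk
    have hpos : 0 < κ' k := by linarith [hκ' k hk]
    have e1 : (n : ℝ)⁻¹ • ∑ i ∈ Finset.range n, (inner ℝ (x i - sampleMean n x) (φ' k) : ℝ) • e i =
        op S (op K (φ' k) + ρ • φ' k) := by
      rw [hS, map_smul, _root_.smul_apply, op_sum_tensor]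
      simp only [hK.inner_resolvent hρ hD]
    have e2 : op K (φ' k) + ρ • φ' k = (κ' k + ρ) • φ' k - op Δ (φ' k) := by
      rw [hΔd, map_sub, _root_.sub_apply, hK'.op_apply, add_smul]
      abel
    rw [op_bHat_sub hn hK' hy hk hpos.ne', e1, e2, map_sub, map_smul, smul_sub, smul_smul]
    refine (norm_sub_sq_le_two_mul _ _).trans ?_
    have hinv : (κ' k)⁻¹ ≤ 2 / ρ := by
      rw [inv_le_comm₀ hpos (by positivity), inv_div]; exact hκ' k hk
    have hinv0 : 0 ≤ (κ' k)⁻¹ := by positivity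
    have h3 : (κ' k)⁻¹ * (κ' k + ρ) ≤ 3 := by
      rw [inv_mul_le_iff₀ hpos]; linarith [hκ' k hk]
    have b1 : ‖((κ' k)⁻¹ * (κ' k + ρ)) • op S (φ' k)‖ ≤ 3 * ‖op S (φ' k)‖ := by
      rw [norm_smul, Real.norm_eq_abs, abs_of_nonneg (by positivity)]
      gcongr
    have b2 : ‖(κ' k)⁻¹ • op S (op Δ (φ' k))‖ ≤ 2 / ρ * (‖S‖ * ‖op Δ (φ' k)‖) := by
      rw [norm_smul, Real.norm_eq_abs, abs_of_nonneg hinv0]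
      gcongr
      exact norm_op_le _ _
    calc _ ≤ 2 * (3 * ‖op S (φ' k)‖) ^ 2 + 2 * (2 / ρ * (‖S‖ * ‖op Δ (φ' k)‖)) ^ 2 := by gcongr
      _ = _ := by ring
  have hsum : ∀ R : L2I2, ∑ k ∈ Finset.range m, ‖op R (φ' k)‖ ^ 2 ≤ ‖R‖ ^ 2 := fun R =>
    sum_le_hasSum _ (fun _ _ => sq_nonneg _) (hasSum_norm_op_sq φ' R)
  have hs := hasSum_norm_op_sq φ' (bHat n m x y κ' φ' - b)
  have htail : ∀ l, ‖op (bHat n m x y κ' φ' - b) (φ' (l + m))‖ ^ 2 = ‖op b (φ' (l + m))‖ ^ 2 := by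
    intro l
    rw [map_sub, _root_.sub_apply, op_bHat, if_neg (by omega), zero_sub, norm_neg]
  rw [← hs.tsum_eq, ← hs.summable.sum_add_tsum_nat_add m]
  simp only [htail]
  gcongr
  calc _ ≤ ∑ k ∈ Finset.range m,
        (18 * ‖op S (φ' k)‖ ^ 2 + 8 / ρ ^ 2 * ‖S‖ ^ 2 * ‖op Δ (φ' k)‖ ^ 2) :=
        Finset.sum_le_sum fun k hk => hterm k (Finset.mem_range.1 hk)
    -- Parseval for `S` and for `Δ`; the second term equals `2 ‖S‖²`, whence `20`.
    _ ≤ 18 * ‖S‖ ^ 2 + 8 / ρ ^ 2 * ‖S‖ ^ 2 * (ρ / 2) ^ 2 := by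
        rw [Finset.sum_add_distrib, ← Finset.mul_sum, ← Finset.mul_sum]
        gcongr
        · exact hsum S
        · exact (hsum Δ).trans (by gcongr)
    _ = 20 * ‖S‖ ^ 2 := by field_simp; ring

/-! ### Elementary inequalities for power sums -/

/-- Two uses of `1 + y ≤ exp y` replace the mean value theorem: `(1 + x⁻¹)^(-p) ≥ exp (-p / x) ≥ 1 -
p / x`. -/
theorem rpow_neg_sub_rpow_neg_le {x p : ℝ} (hx : 0 < x) (hp : 0 ≤ p) :
    x ^ (-p) - (x + 1) ^ (-p) ≤ p * x ^ (-p - 1) := by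
  have h1 : x + 1 = x * (1 + x⁻¹) := by field_simp
  have h2 : 1 - p * x⁻¹ ≤ (1 + x⁻¹) ^ (-p) := by
    have h3 : (Real.exp x⁻¹) ^ (-p) ≤ (1 + x⁻¹) ^ (-p) :=
      Real.rpow_le_rpow_of_nonpos (by positivity)
        (by linarith [Real.add_one_le_exp x⁻¹]) (by linarith)
    rw [← Real.exp_mul] at h3
    linarith [Real.add_one_le_exp (x⁻¹ * -p)]
  rw [h1, Real.mul_rpow hx.le (by positivity), Real.rpow_sub_one hx.ne']
  have h4 : 0 < x ^ (-p) := Real.rpow_pos_of_pos hx _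
  have h5 := mul_le_mul_of_nonneg_left h2 h4.le
  have h6 : p * (x ^ (-p) / x) = x ^ (-p) * (p * x⁻¹) := by ring
  rw [h6]
  linarith

theorem mul_rpow_neg_le_sub {x p : ℝ} (hx : 0 < x) (hp : 0 ≤ p) :
    p * (x + 1) ^ (-p - 1) ≤ x ^ (-p) - (x + 1) ^ (-p) := by
  have hx1 : 0 < x + 1 := by linarith
  have h1 : x = (x + 1) * (1 - (x + 1)⁻¹) := by field_simp; ring
  have h0 : 0 < 1 - (x + 1)⁻¹ := by
    have := inv_lt_one_of_one_lt₀ (show 1 < x + 1 by linarith); linarith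
  have h2 : 1 + p * (x + 1)⁻¹ ≤ (1 - (x + 1)⁻¹) ^ (-p) := by
    have h3 : (Real.exp (-(x + 1)⁻¹)) ^ (-p) ≤ (1 - (x + 1)⁻¹) ^ (-p) :=
      Real.rpow_le_rpow_of_nonpos h0
        (by linarith [Real.add_one_le_exp (-(x + 1)⁻¹)]) (by linarith)
    rw [← Real.exp_mul] at h3
    linarith [Real.add_one_le_exp (-(x + 1)⁻¹ * -p)]
  have h4 : 0 < (x + 1) ^ (-p) := Real.rpow_pos_of_pos hx1 _
  have h5 := mul_le_mul_of_nonneg_left h2 h4.le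
  have h6 : x ^ (-p) = (x + 1) ^ (-p) * (1 - (x + 1)⁻¹) ^ (-p) := by
    conv_lhs => rw [h1]
    rw [Real.mul_rpow hx1.le h0.le]
  rw [h6, Real.rpow_sub_one hx1.ne']
  have h7 : p * ((x + 1) ^ (-p) / (x + 1)) = (x + 1) ^ (-p) * (p * (x + 1)⁻¹) := by ring
  rw [h7]
  linarith

theorem summable_succ_rpow_neg {p : ℝ} (hp : 1 < p) : Summable fun k : ℕ => ((k : ℝ) + 1) ^ (-p) := by
  have h := (summable_nat_add_iff 1).2 (Real.summable_nat_rpow.2 (show -p < -1 by linarith))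
  simpa using h

/-- A discrete integral comparison: each term is at most a decrement of `(p - 1)⁻¹ x^(1-p)`, and
these telescope. -/
theorem tsum_rpow_neg_tail_le {p : ℝ} (hp : 1 < p) {m : ℕ} (hm : 1 ≤ m) :
    ∑' k : ℕ, (((k + m : ℕ) : ℝ) + 1) ^ (-p) ≤ (p - 1)⁻¹ * (m : ℝ) ^ (1 - p) := by
  have hm0 : (0 : ℝ) < m := by exact_mod_cast hm
  have hp0 : 0 < p - 1 := by linarith
  refine Real.tsum_le_of_sum_range_le (fun k => by positivity) fun N => ?_
  have h : ∀ N : ℕ, ∑ k ∈ Finset.range N, (((k + m : ℕ) : ℝ) + 1) ^ (-p) ≤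
      (p - 1)⁻¹ * ((m : ℝ) ^ (1 - p) - ((N + m : ℕ) : ℝ) ^ (1 - p)) := by
    intro N
    induction N with
    | zero => simp
    | succ N ih =>
      rw [Finset.sum_range_succ]
      have h1 := mul_rpow_neg_le_sub (x := ((N + m : ℕ) : ℝ)) (p := p - 1)
        (by push_cast; positivity) hp0.le
      rw [show -(p - 1) - 1 = -p by ring, show -(p - 1) = 1 - p by ring] at h1
      have h2 := mul_le_mul_of_nonneg_left h1 (inv_nonneg.2 hp0.le)
      rw [← mul_assoc, inv_mul_cancel₀ hp0.ne', one_mul] at h2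
      have h3 : (((N + 1 + m : ℕ) : ℝ)) = ((N + m : ℕ) : ℝ) + 1 := by push_cast; ring
      rw [h3]
      linarith
  refine (h N).trans ?_
  gcongr
  have : (0 : ℝ) ≤ ((N + m : ℕ) : ℝ) ^ (1 - p) := by positivity
  linarith

/-- With `A = k + 1` and `d = m - k`, the ratio is `1 + A / d`. If `A ≤ d`, then `A / d ≤ 1`;
otherwise `A^(1-q) / d ≤ d^(-q)`, and reflecting the index turns the sum of `d^(-q)` into that of
`A^(-q)`. No logarithm in `m` appears. -/
theorem sum_rpow_neg_mul_div_le {q : ℝ} (hq : 1 < q) (m : ℕ) :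
    ∑ k ∈ Finset.range m, ((k : ℝ) + 1) ^ (-q) * (((m : ℝ) + 1) / (m - k)) ≤
      3 * ∑' k : ℕ, ((k : ℝ) + 1) ^ (-q) := by
  have hs := summable_succ_rpow_neg hq
  have hle : ∑ k ∈ Finset.range m, ((k : ℝ) + 1) ^ (-q) ≤ ∑' k : ℕ, ((k : ℝ) + 1) ^ (-q) :=
    hs.sum_le_tsum _ fun _ _ => by positivity
  have hrefl : ∑ k ∈ Finset.range m, ((m : ℝ) - k) ^ (-q) =
      ∑ k ∈ Finset.range m, ((k : ℝ) + 1) ^ (-q) := by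
    rw [← Finset.sum_range_reflect]
    refine Finset.sum_congr rfl fun k hk => ?_
    have hk' := Finset.mem_range.1 hk
    rw [show m - 1 - k = m - (k + 1) by omega, Nat.cast_sub hk']
    congr 1
    push_cast
    ring
  have hterm : ∀ k ∈ Finset.range m, ((k : ℝ) + 1) ^ (-q) * (((m : ℝ) + 1) / (m - k)) ≤
      2 * ((k : ℝ) + 1) ^ (-q) + ((m : ℝ) - k) ^ (-q) := by
    intro k hk
    have hk' : (k : ℝ) + 1 ≤ m := by exact_mod_cast Finset.mem_range.1 hk
    have ha : (0 : ℝ) < (k : ℝ) + 1 := by positivity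
    have hd : (0 : ℝ) < (m : ℝ) - k := by linarith
    set A : ℝ := (k : ℝ) + 1 with hA
    set d : ℝ := (m : ℝ) - k with hdd
    have e1 : ((m : ℝ) + 1) / d = 1 + A * d⁻¹ := by rw [hA]; field_simp; rw [hdd]; ring
    have e2 : A ^ (-q) * A = A ^ (1 - q) := by
      rw [show 1 - q = -q + 1 by ring, Real.rpow_add_one ha.ne']
    have hAq : 0 < A ^ (-q) := Real.rpow_pos_of_pos ha _
    have hdq : 0 < d ^ (-q) := Real.rpow_pos_of_pos hd _
    have key : A ^ (-q) * (A * d⁻¹) ≤ A ^ (-q) + d ^ (-q) := by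
      rcases le_total A d with h | h
      · have : A * d⁻¹ ≤ 1 := by rw [mul_inv_le_iff₀ hd]; linarith
        nlinarith
      · have h1 : A ^ (1 - q) ≤ d ^ (1 - q) := Real.rpow_le_rpow_of_nonpos hd h (by linarith)
        have h2 : d ^ (1 - q) * d⁻¹ = d ^ (-q) := by
          rw [show 1 - q = -q + 1 by ring, Real.rpow_add_one hd.ne']
          field_simp
        rw [← mul_assoc, e2]
        have h3 := mul_le_mul_of_nonneg_right h1 (inv_nonneg.2 hd.le)
        linarith
    rw [e1, mul_add, mul_one]
    linarith
  calc _ ≤ ∑ k ∈ Finset.range m, (2 * ((k : ℝ) + 1) ^ (-q) + ((m : ℝ) - k) ^ (-q)) :=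
        Finset.sum_le_sum hterm
    _ = 3 * ∑ k ∈ Finset.range m, ((k : ℝ) + 1) ^ (-q) := by
        rw [Finset.sum_add_distrib, ← Finset.mul_sum, hrefl]; ring
    _ ≤ _ := by gcongr

/-! ### Consequences of the eigenvalue conditions -/

section Eigenvalues

variable {κ : ℕ → ℝ} {α C : ℝ}

theorem eigenvalue_sub_ge (hα : 0 < α) (hC : 0 < C)
    (hgap : ∀ k : ℕ, C⁻¹ * ((k : ℝ) + 1) ^ (-α - 1) ≤ κ k - κ (k + 1)) {k m : ℕ} (hkm : k ≤ m) :
    (C * α)⁻¹ * (((k : ℝ) + 1) ^ (-α) - ((m : ℝ) + 1) ^ (-α)) ≤ κ k - κ m := by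
  induction m, hkm using Nat.le_induction with
  | base => simp
  | succ m _ ih =>
    have h1 := rpow_neg_sub_rpow_neg_le (x := (m : ℝ) + 1) (by positivity) hα.le
    have h2 := mul_le_mul_of_nonneg_left h1 (inv_nonneg.2 (mul_pos hC hα).le)
    have h3 : (C * α)⁻¹ * (α * ((m : ℝ) + 1) ^ (-α - 1)) = C⁻¹ * ((m : ℝ) + 1) ^ (-α - 1) := by
      field_simp
    rw [h3] at h2
    have h4 := hgap m
    push_cast
    linarith

/-- Let `m → ∞` in the telescoped gap condition: the spacings alone force a lower bound of the same
order as the assumed upper one. -/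
theorem eigenvalue_ge (hα : 0 < α) (hC : 0 < C) (h0 : Tendsto κ atTop (𝓝 0))
    (hgap : ∀ k : ℕ, C⁻¹ * ((k : ℝ) + 1) ^ (-α - 1) ≤ κ k - κ (k + 1)) (k : ℕ) :
    (C * α)⁻¹ * ((k : ℝ) + 1) ^ (-α) ≤ κ k := by
  have ht : Tendsto (fun m : ℕ => ((m : ℝ) + 1) ^ (-α)) atTop (𝓝 0) :=
    (tendsto_rpow_neg_atTop hα).comp (tendsto_atTop_add_const_right _ 1 tendsto_natCast_atTop_atTop)
  have h1 : Tendsto (fun m : ℕ => (C * α)⁻¹ * (((k : ℝ) + 1) ^ (-α) - ((m : ℝ) + 1) ^ (-α))) atTop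
      (𝓝 ((C * α)⁻¹ * (((k : ℝ) + 1) ^ (-α) - 0))) := (tendsto_const_nhds.sub ht).const_mul _
  have h2 : Tendsto (fun m => κ k - κ m) atTop (𝓝 (κ k - 0)) := tendsto_const_nhds.sub h0
  rw [sub_zero] at h1 h2
  exact le_of_tendsto_of_tendsto h1 h2
    (eventually_atTop.2 ⟨k, fun m hm => eigenvalue_sub_ge hα hC hgap hm⟩)

/-- Since `α > 1`, `t^α ≤ t` for `t = (k + 1) / (m + 1) ≤ 1`. The factor `(m - k) / (m + 1)` is the
reciprocal of the one in `sum_rpow_neg_mul_div_le`. -/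
theorem eigenvalue_sub_ge_mul (hα : 1 < α) (hC : 0 < C)
    (hgap : ∀ k : ℕ, C⁻¹ * ((k : ℝ) + 1) ^ (-α - 1) ≤ κ k - κ (k + 1)) {k m : ℕ} (hkm : k ≤ m) :
    (C * α)⁻¹ * ((k : ℝ) + 1) ^ (-α) * (((m : ℝ) - k) / (m + 1)) ≤ κ k - κ m := by
  refine le_trans ?_ (eigenvalue_sub_ge (by linarith) hC hgap hkm)
  have hα0 : 0 < α := by linarith
  rw [mul_assoc]
  gcongr
  have hk : (0 : ℝ) < (k : ℝ) + 1 := by positivity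
  have hm : (0 : ℝ) < (m : ℝ) + 1 := by positivity
  have hkm' : (k : ℝ) ≤ m := by exact_mod_cast hkm
  have h1 : (((k : ℝ) + 1) / (m + 1)) ^ α ≤ ((k : ℝ) + 1) / (m + 1) := by
    refine Real.rpow_le_self_of_le_one (by positivity) ?_ hα.le
    rw [div_le_one hm]; linarith
  have h2 : ((m : ℝ) + 1) ^ (-α) = ((k : ℝ) + 1) ^ (-α) * (((k : ℝ) + 1) / (m + 1)) ^ α := by
    rw [Real.div_rpow hk.le hm.le, Real.rpow_neg hk.le, Real.rpow_neg hm.le]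
    have := (Real.rpow_pos_of_pos hk α).ne'
    field_simp
  have h3 : ((m : ℝ) - k) / (m + 1) = 1 - ((k : ℝ) + 1) / (m + 1) := by field_simp; ring
  rw [h2, h3]
  have h4 : 0 < ((k : ℝ) + 1) ^ (-α) := Real.rpow_pos_of_pos hk _
  nlinarith

theorem summable_eigenvalue (hα : 1 < α) (hnn : ∀ k, 0 ≤ κ k)
    (hκ : ∀ k : ℕ, κ k ≤ C * ((k : ℝ) + 1) ^ (-α)) : Summable κ :=
  Summable.of_nonneg_of_le hnn hκ ((summable_succ_rpow_neg hα).mul_left C)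

/-- The effective dimension of the regularized problem. -/
theorem tsum_eigenvalue_div_sq_le (hα : 1 < α) (hC : 0 < C)
    (h0 : Tendsto κ atTop (𝓝 0)) (hnn : ∀ k, 0 ≤ κ k)
    (hκ : ∀ k : ℕ, κ k ≤ C * ((k : ℝ) + 1) ^ (-α))
    (hgap : ∀ k : ℕ, C⁻¹ * ((k : ℝ) + 1) ^ (-α - 1) ≤ κ k - κ (k + 1)) {m : ℕ} (hm : 1 ≤ m) :
    (Summable fun k => (κ k + κ (m - 1))⁻¹ ^ 2 * κ k) ∧
    ∑' k, (κ k + κ (m - 1))⁻¹ ^ 2 * κ k ≤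
      (C * α + C ^ 3 * α ^ 2 * (α - 1)⁻¹) * (m : ℝ) ^ (α + 1) := by
  have hα0 : 0 < α := by linarith
  have hlow := eigenvalue_ge hα0 hC h0 hgap
  have hpos : ∀ k, 0 < κ k := fun k => lt_of_lt_of_le (by positivity) (hlow k)
  have hm0 : (0 : ℝ) < m := by exact_mod_cast hm
  set ρ := κ (m - 1) with hρ
  have hρ0 : 0 < ρ := hpos _
  have hinv : ∀ k : ℕ, (κ k)⁻¹ ≤ C * α * ((k : ℝ) + 1) ^ α := by
    intro k
    have h1 := inv_anti₀ (by positivity) (hlow k)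
    rwa [mul_inv, inv_inv, ← Real.rpow_neg (by positivity), neg_neg] at h1
  have hρinv : ρ⁻¹ ≤ C * α * (m : ℝ) ^ α := by
    have h1 := hinv (m - 1)
    rwa [Nat.cast_sub hm, Nat.cast_one, sub_add_cancel] at h1
  -- This bound serves for `k < m`, giving `m` terms of order at most `m^α`; `hle2` serves for `k ≥
  -- m`, where `ρ⁻²` is of order `m^(2α)` and the eigenvalue tail of order `m^(1-α)`.
  have hle1 : ∀ k, (κ k + ρ)⁻¹ ^ 2 * κ k ≤ (κ k)⁻¹ := by
    intro k
    have h1 : (κ k + ρ)⁻¹ ≤ (κ k)⁻¹ := inv_anti₀ (hpos k) (by linarith)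
    have h2 := hpos k
    calc _ ≤ (κ k)⁻¹ ^ 2 * κ k := by gcongr
      _ = _ := by field_simp
  have hle2 : ∀ k, (κ k + ρ)⁻¹ ^ 2 * κ k ≤ ρ⁻¹ ^ 2 * κ k := by
    intro k
    have h2 := hpos k
    have h1 : (κ k + ρ)⁻¹ ≤ ρ⁻¹ := inv_anti₀ hρ0 (by linarith)
    gcongr
  have hnn' : ∀ k, 0 ≤ (κ k + ρ)⁻¹ ^ 2 * κ k := fun k => mul_nonneg (sq_nonneg _) (hnn k)
  have hsum : Summable fun k => (κ k + ρ)⁻¹ ^ 2 * κ k :=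
    Summable.of_nonneg_of_le hnn' hle2 ((summable_eigenvalue hα hnn hκ).mul_left _)
  refine ⟨hsum, ?_⟩
  rw [← hsum.sum_add_tsum_nat_add m, add_mul]
  refine add_le_add ?_ ?_
  · calc _ ≤ ∑ k ∈ Finset.range m, C * α * (m : ℝ) ^ α := by
          refine Finset.sum_le_sum fun k hk => (hle1 k).trans ((hinv k).trans ?_)
          have : (k : ℝ) + 1 ≤ m := by exact_mod_cast Finset.mem_range.1 hk
          gcongr
      _ = _ := by
          rw [Finset.sum_const, Finset.card_range, nsmul_eq_mul, Real.rpow_add_one hm0.ne']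
          ring
  · have hs := (summable_nat_add_iff m).2 (summable_succ_rpow_neg hα)
    calc ∑' k, (κ (k + m) + ρ)⁻¹ ^ 2 * κ (k + m)
        ≤ ∑' k : ℕ, (C * α * (m : ℝ) ^ α) ^ 2 * C * (((k + m : ℕ) : ℝ) + 1) ^ (-α) := by
          refine Summable.tsum_le_tsum (fun k => ?_) ((summable_nat_add_iff m).2 hsum)
            (hs.mul_left _)
          refine (hle2 _).trans ?_
          rw [mul_assoc]
          have h1 := hκ (k + m)
          have h2 := hnn (k + m)
          gcongr
      _ = (C * α * (m : ℝ) ^ α) ^ 2 * C * ∑' k : ℕ, (((k + m : ℕ) : ℝ) + 1) ^ (-α) := tsum_mul_left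
      _ ≤ (C * α * (m : ℝ) ^ α) ^ 2 * C * ((α - 1)⁻¹ * (m : ℝ) ^ (1 - α)) := by
          gcongr
          exact tsum_rpow_neg_tail_le hα hm
      _ = C ^ 3 * α ^ 2 * (α - 1)⁻¹ * ((m : ℝ) ^ α * (m : ℝ) ^ α * (m : ℝ) ^ (1 - α)) := by ring
      _ = _ := by
          rw [← Real.rpow_add hm0, ← Real.rpow_add hm0]
          congr 2
          ring

end Eigenvalues

instance : Fact ((2 : ENNReal) ≠ ⊤) := ⟨by norm_num⟩

instance : SFinite (volume : Measure (I × I)) :=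
  inferInstanceAs (SFinite ((volume : Measure I).prod volume))

/-! ### Moments of series and of averages of independent variables -/

section Moments

variable {Ω : Type*} [mΩ : MeasurableSpace Ω] {P : Measure Ω}

/-- Tonelli. Integrability of `g` is a conclusion, so moments of norms can be derived from moments
of coordinates. -/
theorem integral_le_tsum_of_hasSum {f : ℕ → Ω → ℝ} {g : Ω → ℝ} {a : ℕ → ℝ}
    (hf : ∀ k, Integrable (f k) P) (hnn : ∀ k ω, 0 ≤ f k ω)
    (hg : ∀ ω, HasSum (fun k => f k ω) (g ω)) (ha : Summable a) (hfa : ∀ k, ∫ ω, f k ω ∂P ≤ a k) :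
    Integrable g P ∧ ∫ ω, g ω ∂P ≤ ∑' k, a k := by
  have hs : Summable fun k => ∫ ω, f k ω ∂P :=
    Summable.of_nonneg_of_le (fun k => integral_nonneg (hnn k)) hfa ha
  have hs' : Summable fun k => ∫ ω, ‖f k ω‖ ∂P := by
    simpa only [Real.norm_eq_abs, abs_of_nonneg (hnn _ _)] using hs
  have hgt : (fun ω => ∑' k, f k ω) = g := funext fun ω => (hg ω).tsum_eq
  have hint := hasSum_integral_of_summable_integral_norm hf hs'
  rw [hgt] at hint
  refine ⟨?_, hint.tsum_eq ▸ hs.tsum_le_tsum hfa ha⟩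
  have hgm : AEStronglyMeasurable g P := by
    refine aestronglyMeasurable_of_tendsto_ae atTop
      (f := fun n ω => ∑ k ∈ Finset.range n, f k ω) (fun n => ?_)
      (Eventually.of_forall fun ω => (hg ω).tendsto_sum_nat)
    exact Finset.aestronglyMeasurable_fun_sum _ fun k _ => (hf k).1
  refine ⟨hgm, ?_⟩
  rw [hasFiniteIntegral_iff_ofReal (Eventually.of_forall fun ω => (hg ω).nonneg fun k => hnn k ω)]
  have h1 : ∀ ω, ENNReal.ofReal (g ω) = ∑' k, ENNReal.ofReal (f k ω) := fun ω => by
    rw [← (hg ω).tsum_eq, ENNReal.ofReal_tsum_of_nonneg (fun k => hnn k ω) (hg ω).summable]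
  simp only [h1]
  rw [lintegral_tsum fun k => (hf k).1.aemeasurable.ennreal_ofReal]
  have h2 : ∀ k, ∫⁻ ω, ENNReal.ofReal (f k ω) ∂P = ENNReal.ofReal (∫ ω, f k ω ∂P) := fun k =>
    (ofReal_integral_eq_lintegral_ofReal (hf k) (Eventually.of_forall (hnn k))).symm
  simp only [h2]
  rw [← ENNReal.ofReal_tsum_of_nonneg (fun k => integral_nonneg (hnn k)) hs]
  exact ENNReal.ofReal_lt_top

theorem integrable_inner_of_memLp {H : Type*} [NormedAddCommGroup H] [InnerProductSpace ℝ H]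
    {f g : Ω → H} (hf : MemLp f 2 P) (hg : MemLp g 2 P) :
    Integrable (fun ω => (inner ℝ (f ω) (g ω) : ℝ)) P := by
  refine (hf.norm.integrable_mul hg.norm).mono' (hf.1.inner hg.1) ?_
  exact Eventually.of_forall fun ω => norm_inner_le_norm _ _

/-- Expand the square: off-diagonal inner products integrate to zero by independence and centring,
leaving `n` diagonal terms. -/
theorem integral_norm_sq_mean {H : Type*} [NormedAddCommGroup H] [InnerProductSpace ℝ H]
    [CompleteSpace H] [MeasurableSpace H] [BorelSpace H] [IsProbabilityMeasure P]
    {Z : ℕ → Ω → H} (hind : Pairwise fun i j => IndepFun (Z i) (Z j) P)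
    (hZ : ∀ i, MemLp (Z i) 2 P) (h0 : ∀ i, ∫ ω, Z i ω ∂P = 0) {v : ℝ}
    (hv : ∀ i, ∫ ω, ‖Z i ω‖ ^ 2 ∂P = v) {n : ℕ} (hn : n ≠ 0) :
    Integrable (fun ω => ‖(n : ℝ)⁻¹ • ∑ i ∈ Finset.range n, Z i ω‖ ^ 2) P ∧
    ∫ ω, ‖(n : ℝ)⁻¹ • ∑ i ∈ Finset.range n, Z i ω‖ ^ 2 ∂P = (n : ℝ)⁻¹ * v := by
  have hexp : ∀ ω, ‖(n : ℝ)⁻¹ • ∑ i ∈ Finset.range n, Z i ω‖ ^ 2 =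
      (n : ℝ)⁻¹ ^ 2 * ∑ i ∈ Finset.range n, ∑ j ∈ Finset.range n,
        (inner ℝ (Z i ω) (Z j ω) : ℝ) := by
    intro ω
    rw [norm_smul, mul_pow, Real.norm_eq_abs, sq_abs, ← real_inner_self_eq_norm_sq, sum_inner]
    simp only [inner_sum]
  have hint : ∀ i j, Integrable (fun ω => (inner ℝ (Z i ω) (Z j ω) : ℝ)) P := fun i j =>
    integrable_inner_of_memLp (hZ i) (hZ j)
  have hval : ∀ i j, ∫ ω, (inner ℝ (Z i ω) (Z j ω) : ℝ) ∂P = if i = j then v else 0 := by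
    intro i j
    split_ifs with hij
    · subst hij
      simp only [real_inner_self_eq_norm_sq, hv]
    · have h := (hind hij).integral_bilin ((hZ i).integrable one_le_two)
        ((hZ j).integrable one_le_two) (innerSL ℝ (E := H))
      rw [h0, h0, map_zero] at h
      exact h
  have hint2 : ∀ i, Integrable (fun ω => ∑ j ∈ Finset.range n, (inner ℝ (Z i ω) (Z j ω) : ℝ)) P :=
    fun i => integrable_finsetSum _ fun j _ => hint i j
  simp only [hexp]
  refine ⟨(integrable_finsetSum _ fun i _ => hint2 i).const_mul _, ?_⟩
  rw [integral_const_mul, integral_finsetSum _ fun i _ => hint2 i]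
  have h3 : ∀ i ∈ Finset.range n,
      ∫ ω, ∑ j ∈ Finset.range n, (inner ℝ (Z i ω) (Z j ω) : ℝ) ∂P = v := by
    intro i hi
    rw [integral_finsetSum _ fun j _ => hint i j]
    simp only [hval, Finset.sum_ite_eq, if_pos hi]
  rw [Finset.sum_congr rfl h3, Finset.sum_const, Finset.card_range, nsmul_eq_mul]
  have : (n : ℝ) ≠ 0 := by exact_mod_cast hn
  field_simp

/-- The second moment of the sample mean of a centred function of independent copies. -/
theorem integral_norm_sq_mean_copies {H : Type*} [NormedAddCommGroup H] [InnerProductSpace ℝ H]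
    [CompleteSpace H] [SecondCountableTopology H] [IsProbabilityMeasure P]
    {X Y : Ω → L2I} {Xs Ys : ℕ → Ω → L2I}
    (hindep : iIndepFun (fun i ω => (Xs i ω, Ys i ω)) P)
    (hident : ∀ i, IdentDistrib (fun ω => (Xs i ω, Ys i ω)) (fun ω => (X ω, Y ω)) P P)
    {F : L2I × L2I → H} (hF : Continuous F) (h2 : MemLp (fun ω => F (X ω, Y ω)) 2 P)
    (h0 : ∫ ω, F (X ω, Y ω) ∂P = 0) {n : ℕ} (hn : n ≠ 0) :
    Integrable (fun ω => ‖(n : ℝ)⁻¹ • ∑ i ∈ Finset.range n, F (Xs i ω, Ys i ω)‖ ^ 2) P ∧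
    ∫ ω, ‖(n : ℝ)⁻¹ • ∑ i ∈ Finset.range n, F (Xs i ω, Ys i ω)‖ ^ 2 ∂P =
      (n : ℝ)⁻¹ * ∫ ω, ‖F (X ω, Y ω)‖ ^ 2 ∂P := by
  let : MeasurableSpace H := borel H
  have : BorelSpace H := ⟨rfl⟩
  have hid : ∀ i, IdentDistrib (fun ω => F (Xs i ω, Ys i ω)) (fun ω => F (X ω, Y ω)) P P :=
    fun i => (hident i).comp hF.measurable
  refine integral_norm_sq_mean (fun i j hij => ?_) (fun i => (hid i).memLp_iff.2 h2)
    (fun i => (hid i).integral_eq.trans h0) (fun i => (hid i).norm.sq.integral_eq) hn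
  exact (hindep.indepFun hij).comp hF.measurable hF.measurable

end Moments

/-! ### Moments of the scores and of the noise -/

section Population

variable {Ω : Type*} [mΩ : MeasurableSpace Ω] {P : Measure Ω}
  {X Y : Ω → L2I} {κ : ℕ → ℝ} {φ : HilbertBasis ℕ ℝ L2I} {C₁ : ℝ}

theorem score_eq_inner (X : Ω → L2I) (φ : HilbertBasis ℕ ℝ L2I) (k : ℕ) (ω : Ω) :
    score P X φ k ω = inner ℝ (φ k) (X ω - ∫ ω', X ω' ∂P) := by
  rw [real_inner_comm, inner_L2I, score]

theorem hasSum_score_sq (X : Ω → L2I) (φ : HilbertBasis ℕ ℝ L2I) (ω : Ω) :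
    HasSum (fun k => score P X φ k ω ^ 2) (‖X ω - ∫ ω', X ω' ∂P‖ ^ 2) := by
  simpa only [score_eq_inner] using hasSum_inner_sq φ (X ω - ∫ ω', X ω' ∂P)

/-- The error of the regression of `y` on `x` with slope `b`. -/
def noise (P : Measure Ω) (X Y : Ω → L2I) (b : L2I2) (z : L2I × L2I) : L2I :=
  (z.2 - ∫ ω, Y ω ∂P) - op b (z.1 - ∫ ω, X ω ∂P)

theorem continuous_noise (P : Measure Ω) (X Y : Ω → L2I) (b : L2I2) :
    Continuous (noise P X Y b) := by
  unfold noise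
  fun_prop

theorem noise_ae_eq {b : L2I2} (hmodel : FunctionalLinearModel P X Y b) :
    (fun ω => noise P X Y b (X ω, Y ω)) =ᵐ[P] fun ω => Y ω - condExpGiven P X Y ω := by
  filter_upwards [hmodel] with ω hω
  have h : condExpGiven P X Y ω = (∫ ω', Y ω' ∂P) + op b (X ω - ∫ ω', X ω' ∂P) := by
    refine Lp.ext ?_
    filter_upwards [hω, op_ae_eq b (X ω - ∫ ω', X ω' ∂P),
      Lp.coeFn_add (∫ ω', Y ω' ∂P) (op b (X ω - ∫ ω', X ω' ∂P))] with s h1 h2 h3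
    rw [h1, h3, Pi.add_apply, h2]
  rw [h, noise]
  abel

variable [IsProbabilityMeasure P]

theorem memLp_center (hX2 : MemLp X 2 P) : MemLp (fun ω => X ω - ∫ ω', X ω' ∂P) 2 P :=
  hX2.sub (memLp_const _)

theorem integral_center (hX2 : MemLp X 2 P) : ∫ ω, (X ω - ∫ ω', X ω' ∂P) ∂P = 0 := by
  rw [integral_sub (hX2.integrable one_le_two) (integrable_const _)]
  simp

theorem memLp_score (hX2 : MemLp X 2 P) (φ : HilbertBasis ℕ ℝ L2I) (k : ℕ) :
    MemLp (score P X φ k) 2 P := by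
  have h := (memLp_center hX2).const_inner (𝕜 := ℝ) (φ k)
  exact h.congr_norm (h.1.congr (Eventually.of_forall fun ω => (score_eq_inner X φ k ω).symm))
    (Eventually.of_forall fun ω => by rw [score_eq_inner])

theorem aestronglyMeasurable_tensor {Ω : Type*} [MeasurableSpace Ω] {P : Measure Ω}
    {f g : Ω → L2I} (hf : AEStronglyMeasurable f P) (hg : AEStronglyMeasurable g P) :
    AEStronglyMeasurable (fun ω => tensor (f ω) (g ω)) P :=
  continuous_tensor.comp_aestronglyMeasurable (hf.prodMk hg)

theorem integrable_tensor_center (hX2 : MemLp X 2 P) :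
    Integrable (fun ω => tensor (X ω - ∫ ω', X ω' ∂P) (X ω - ∫ ω', X ω' ∂P)) P := by
  have h := memLp_center hX2
  refine h.integrable_norm_pow two_ne_zero |>.mono' (aestronglyMeasurable_tensor h.1 h.1) ?_
  exact Eventually.of_forall fun ω => by rw [norm_tensor, sq]

theorem integral_score_sq (hX2 : MemLp X 2 P) (hK : IsSpectralExpansion (covFun P X) κ φ)
    (k : ℕ) : ∫ ω, score P X φ k ω ^ 2 ∂P = κ k := by
  have h1 : inner ℝ (op (covFun P X) (φ k)) (φ k) = κ k := by
    rw [hK.op_apply, real_inner_smul_left, real_inner_self_eq_norm_sq, φ.orthonormal.1]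
    simp
  rw [inner_op_left, real_inner_comm, covFun, ← integral_inner (integrable_tensor_center hX2)] at h1
  rw [← h1]
  congr 1
  ext ω
  rw [inner_tensor_tensor, score_eq_inner, sq]

theorem integral_score_sq_mul (hX2 : MemLp X 2 P) (hpos : ∀ k, 0 < κ k)
    (hξ : ∀ k, MemLp (score P X φ k) 4 P ∧ ∫ ω, score P X φ k ω ^ 4 ∂P ≤ C₁ * κ k ^ 2)
    (j k : ℕ) :
    Integrable (fun ω => score P X φ j ω ^ 2 * score P X φ k ω ^ 2) P ∧
    ∫ ω, score P X φ j ω ^ 2 * score P X φ k ω ^ 2 ∂P ≤ C₁ * κ j * κ k := by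
  have h4 : ∀ k, Integrable (fun ω => score P X φ k ω ^ 4) P := fun k => by
    have h := (hξ k).1.integrable_norm_pow (p := 4) (by norm_num)
    refine h.congr (Eventually.of_forall fun ω => ?_)
    simp only [Real.norm_eq_abs]
    exact (show Even 4 by decide).pow_abs _
  have hj := hpos j
  have hk := hpos k
  -- The weights in this arithmetic–geometric mean inequality make both fourth-moment bounds equal
  -- to `C₁ κ_j κ_k / 2`.
  have hle : ∀ ω, score P X φ j ω ^ 2 * score P X φ k ω ^ 2 ≤
      κ k / (2 * κ j) * score P X φ j ω ^ 4 + κ j / (2 * κ k) * score P X φ k ω ^ 4 := by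
    intro ω
    have h := sq_nonneg (κ k * score P X φ j ω ^ 2 - κ j * score P X φ k ω ^ 2)
    have h2 : κ k / (2 * κ j) * score P X φ j ω ^ 4 + κ j / (2 * κ k) * score P X φ k ω ^ 4 -
        score P X φ j ω ^ 2 * score P X φ k ω ^ 2 =
        (κ k * score P X φ j ω ^ 2 - κ j * score P X φ k ω ^ 2) ^ 2 / (2 * κ j * κ k) := by
      field_simp
      ring
    have h3 : 0 ≤ (κ k * score P X φ j ω ^ 2 - κ j * score P X φ k ω ^ 2) ^ 2 /
      (2 * κ j * κ k) := by positivity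
    linarith
  have hi : Integrable (fun ω => κ k / (2 * κ j) * score P X φ j ω ^ 4 +
      κ j / (2 * κ k) * score P X φ k ω ^ 4) P := ((h4 j).const_mul _).add ((h4 k).const_mul _)
  have hint : Integrable (fun ω => score P X φ j ω ^ 2 * score P X φ k ω ^ 2) P := by
    refine hi.mono' (((memLp_score hX2 φ j).1.pow 2).mul ((memLp_score hX2 φ k).1.pow 2)) ?_
    refine Eventually.of_forall fun ω => ?_
    rw [Real.norm_eq_abs, abs_of_nonneg (by positivity)]
    exact hle ω
  refine ⟨hint, (integral_mono hint hi hle).trans ?_⟩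
  rw [integral_add ((h4 j).const_mul _) ((h4 k).const_mul _), integral_const_mul,
    integral_const_mul]
  calc _ ≤ κ k / (2 * κ j) * (C₁ * κ j ^ 2) + κ j / (2 * κ k) * (C₁ * κ k ^ 2) := by
        gcongr
        · exact (hξ j).2
        · exact (hξ k).2
    _ = _ := by field_simp; ring

theorem integral_norm_center_sq_mul (hX2 : MemLp X 2 P) (hpos : ∀ k, 0 < κ k) (hs : Summable κ)
    (hξ : ∀ k, MemLp (score P X φ k) 4 P ∧ ∫ ω, score P X φ k ω ^ 4 ∂P ≤ C₁ * κ k ^ 2) (k : ℕ) :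
    Integrable (fun ω => ‖X ω - ∫ ω', X ω' ∂P‖ ^ 2 * score P X φ k ω ^ 2) P ∧
    ∫ ω, ‖X ω - ∫ ω', X ω' ∂P‖ ^ 2 * score P X φ k ω ^ 2 ∂P ≤ C₁ * (∑' j, κ j) * κ k := by
  have h := integral_le_tsum_of_hasSum (P := P)
    (f := fun j ω => score P X φ j ω ^ 2 * score P X φ k ω ^ 2)
    (fun j => (integral_score_sq_mul hX2 hpos hξ j k).1) (fun _ _ => by positivity)
    (fun ω => (hasSum_score_sq X φ ω).mul_right _) ((hs.mul_left C₁).mul_right (κ k))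
    (fun j => (integral_score_sq_mul hX2 hpos hξ j k).2)
  rwa [tsum_mul_right, tsum_mul_left] at h

/-- A second summation over the scores. The fourth moment of the norm is not assumed; it follows
from the score condition and `∑ κ_k < ∞`. -/
theorem integral_norm_center_pow_four (hX2 : MemLp X 2 P) (hpos : ∀ k, 0 < κ k) (hs : Summable κ)
    (hξ : ∀ k, MemLp (score P X φ k) 4 P ∧ ∫ ω, score P X φ k ω ^ 4 ∂P ≤ C₁ * κ k ^ 2) :
    Integrable (fun ω => ‖X ω - ∫ ω', X ω' ∂P‖ ^ 4) P ∧
    ∫ ω, ‖X ω - ∫ ω', X ω' ∂P‖ ^ 4 ∂P ≤ C₁ * (∑' j, κ j) ^ 2 := by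
  have h := integral_le_tsum_of_hasSum (P := P)
    (f := fun j ω => ‖X ω - ∫ ω', X ω' ∂P‖ ^ 2 * score P X φ j ω ^ 2)
    (g := fun ω => ‖X ω - ∫ ω', X ω' ∂P‖ ^ 4)
    (fun j => (integral_norm_center_sq_mul hX2 hpos hs hξ j).1) (fun _ _ => by positivity)
    (fun ω => by
      have h := (hasSum_score_sq (P := P) X φ ω).mul_left (‖X ω - ∫ ω', X ω' ∂P‖ ^ 2)
      rwa [← pow_add] at h)
    (hs.mul_left (C₁ * ∑' j, κ j))
    (fun j => (integral_norm_center_sq_mul hX2 hpos hs hξ j).2)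
  rw [tsum_mul_left] at h
  refine ⟨h.1, h.2.trans_eq (by ring)⟩

theorem integral_norm_diag_center_sq (hX2 : MemLp X 2 P)
    (hK : IsSpectralExpansion (covFun P X) κ φ) {D : L2I →L[ℝ] L2I} {d : ℕ → ℝ}
    (hD : ∀ k x, inner ℝ (φ k) (D x) = d k * inner ℝ (φ k) x)
    (hs : Summable fun k => d k ^ 2 * κ k) :
    Integrable (fun ω => ‖D (X ω - ∫ ω', X ω' ∂P)‖ ^ 2) P ∧
    ∫ ω, ‖D (X ω - ∫ ω', X ω' ∂P)‖ ^ 2 ∂P ≤ ∑' k, d k ^ 2 * κ k := by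
  refine integral_le_tsum_of_hasSum (f := fun k ω => d k ^ 2 * score P X φ k ω ^ 2)
    (fun k => (memLp_score hX2 φ k).integrable_sq.const_mul _) (fun _ _ => by positivity)
    (fun ω => ?_) hs (fun k => ?_)
  · have h := hasSum_inner_sq φ (D (X ω - ∫ ω', X ω' ∂P))
    simp only [hD, ← score_eq_inner, mul_pow] at h
    exact h
  · rw [integral_const_mul, integral_score_sq hX2 hK]

theorem memLp_noise (hX2 : MemLp X 2 P) (hY2 : MemLp Y 2 P) (b : L2I2) :
    MemLp (fun ω => noise P X Y b (X ω, Y ω)) 2 P :=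
  (memLp_center hY2).sub ((op b).comp_memLp' (memLp_center hX2))

/-- Under the model the noise is almost surely `Y - E(Y ∣ X)`, and `ζ (X)` can be taken inside the
conditional expectation. -/
theorem integral_smul_noise (hX : Measurable X) (hX2 : MemLp X 2 P) (hY2 : MemLp Y 2 P) {b : L2I2}
    (hmodel : FunctionalLinearModel P X Y b) {ζ : L2I → ℝ} (hζ : Continuous ζ)
    (hζ2 : MemLp (fun ω => ζ (X ω)) 2 P) :
    ∫ ω, ζ (X ω) • noise P X Y b (X ω, Y ω) ∂P = 0 := by
  have hm : MeasurableSpace.comap X inferInstance ≤ mΩ := hX.comap_le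
  have hY1 := hY2.integrable one_le_two
  have hζm : StronglyMeasurable[MeasurableSpace.comap X inferInstance] fun ω => ζ (X ω) :=
    (hζ.measurable.comp (comap_measurable X)).stronglyMeasurable
  have hYζ : Integrable ((fun ω => ζ (X ω)) • Y) P := hY2.smul hζ2 |>.integrable le_rfl
  have hpull := condExp_smul_of_aestronglyMeasurable_left hζm.aestronglyMeasurable hYζ hY1
  have hnoise : Integrable (fun ω => ζ (X ω) • noise P X Y b (X ω, Y ω)) P :=
    (memLp_noise hX2 hY2 b).smul hζ2 |>.integrable le_rfl
  have h1 : (fun ω => ζ (X ω) • noise P X Y b (X ω, Y ω)) =ᵐ[P]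
      fun ω => ((fun ω => ζ (X ω)) • Y) ω -
        (P[(fun ω => ζ (X ω)) • Y | MeasurableSpace.comap X inferInstance]) ω := by
    filter_upwards [noise_ae_eq hmodel, hpull] with ω h2 h3
    rw [h2, h3, smul_sub]
    rfl
  rw [integral_congr_ae h1, integral_sub hYζ integrable_condExp, integral_condExp hm, sub_self]

theorem integral_noise (hX : Measurable X) (hX2 : MemLp X 2 P) (hY2 : MemLp Y 2 P) {b : L2I2}
    (hmodel : FunctionalLinearModel P X Y b) : ∫ ω, noise P X Y b (X ω, Y ω) ∂P = 0 := by
  simpa using integral_smul_noise hX hX2 hY2 hmodel (ζ := fun _ => 1) continuous_const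
    (memLp_const 1)

/-- Integrability of the product is not known beforehand, so the pull-out property does not apply
directly. Instead the measure with density `‖noise‖²` is compared with `C₁ • P` on the σ-field of
`X`, and `ζ (X)` is integrated against both. -/
theorem integral_noise_sq_mul_le (hX : Measurable X) (hX2 : MemLp X 2 P) (hY2 : MemLp Y 2 P)
    {b : L2I2} (hmodel : FunctionalLinearModel P X Y b) (hC : 0 ≤ C₁)
    (hE : ∀ᵐ ω ∂P, condErrorVar P X Y ω ≤ C₁) {ζ : L2I → ℝ} (hζ : Continuous ζ)
    (hζ0 : ∀ x, 0 ≤ ζ x) (hζ1 : Integrable (fun ω => ζ (X ω)) P) :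
    Integrable (fun ω => ‖noise P X Y b (X ω, Y ω)‖ ^ 2 * ζ (X ω)) P ∧
    ∫ ω, ‖noise P X Y b (X ω, Y ω)‖ ^ 2 * ζ (X ω) ∂P ≤ C₁ * ∫ ω, ζ (X ω) ∂P := by
  have hm : MeasurableSpace.comap X inferInstance ≤ mΩ := hX.comap_le
  set N : Ω → ℝ := fun ω => ‖noise P X Y b (X ω, Y ω)‖ ^ 2 with hN
  have hNi : Integrable N P := (memLp_noise hX2 hY2 b).integrable_norm_pow two_ne_zero
  have hN0 : ∀ ω, 0 ≤ N ω := fun ω => sq_nonneg _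
  have hNE : P[N | MeasurableSpace.comap X inferInstance] =ᵐ[P] condErrorVar P X Y := by
    refine condExp_congr_ae ?_
    filter_upwards [noise_ae_eq hmodel] with ω hω
    rw [hN]
    simp only [hω]
  have hNm : AEMeasurable (fun ω => ENNReal.ofReal (N ω)) P := hNi.1.aemeasurable.ennreal_ofReal
  set ν : Measure Ω := P.withDensity fun ω => ENNReal.ofReal (N ω) with hν
  have hle : ν.trim hm ≤ (ENNReal.ofReal C₁ • P).trim hm := by
    refine Measure.le_iff.2 fun A hA => ?_
    rw [trim_measurableSet_eq hm hA, trim_measurableSet_eq hm hA, hν,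
      withDensity_apply _ (hm _ hA), Measure.smul_apply, smul_eq_mul,
      ← ofReal_integral_eq_lintegral_ofReal hNi.integrableOn (Eventually.of_forall hN0),
      ← setIntegral_condExp hm hNi hA]
    have h1 : ∫ ω in A, (P[N | MeasurableSpace.comap X inferInstance]) ω ∂P ≤
        ∫ _ in A, C₁ ∂P := by
      refine setIntegral_mono_ae integrable_condExp.integrableOn (integrable_const _).integrableOn ?_
      filter_upwards [hNE, hE] with ω h2 h3
      rw [h2]; exact h3
    rw [setIntegral_const, smul_eq_mul, mul_comm] at h1
    refine (ENNReal.ofReal_le_ofReal h1).trans_eq ?_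
    rw [ENNReal.ofReal_mul hC, Measure.real, ENNReal.ofReal_toReal (measure_ne_top _ _)]
  have hζm : Measurable[MeasurableSpace.comap X inferInstance] fun ω => ENNReal.ofReal (ζ (X ω)) :=
    (hζ.measurable.comp (comap_measurable X)).ennreal_ofReal
  have hlin : ∫⁻ ω, ENNReal.ofReal (N ω * ζ (X ω)) ∂P ≤
      ENNReal.ofReal (C₁ * ∫ ω, ζ (X ω) ∂P) := by
    have h1 := lintegral_mono' hle (le_refl fun ω => ENNReal.ofReal (ζ (X ω)))
    rw [lintegral_trim hm hζm, lintegral_trim hm hζm, lintegral_smul_measure, hν,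
      lintegral_withDensity_eq_lintegral_mul₀ hNm (hζm.mono hm le_rfl).aemeasurable,
      ← ofReal_integral_eq_lintegral_ofReal hζ1 (Eventually.of_forall fun ω => hζ0 _),
      smul_eq_mul, ← ENNReal.ofReal_mul hC] at h1
    refine le_trans (le_of_eq (lintegral_congr fun ω => ?_)) h1
    rw [ENNReal.ofReal_mul (hN0 ω)]
    rfl
  have hnn : ∀ ω, 0 ≤ N ω * ζ (X ω) := fun ω => mul_nonneg (hN0 ω) (hζ0 _)
  have hint : Integrable (fun ω => N ω * ζ (X ω)) P := by
    refine ⟨hNi.1.mul hζ1.1, ?_⟩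
    rw [hasFiniteIntegral_iff_ofReal (Eventually.of_forall hnn)]
    exact hlin.trans_lt ENNReal.ofReal_lt_top
  refine ⟨hint, ?_⟩
  rw [← ofReal_integral_eq_lintegral_ofReal hint (Eventually.of_forall hnn)] at hlin
  exact (ENNReal.ofReal_le_ofReal_iff
    (mul_nonneg hC (integral_nonneg fun ω => hζ0 _))).1 hlin

end Population

/-! ### Centring at the population mean and the bound on the good event -/

/-- The average of the first `n` terms of a sequence. -/
def average {H : Type*} [AddCommGroup H] [Module ℝ H] (n : ℕ) (z : ℕ → H) : H :=
  (n : ℝ)⁻¹ • ∑ i ∈ Finset.range n, z i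

theorem map_average {H H' : Type*} [NormedAddCommGroup H] [NormedSpace ℝ H]
    [NormedAddCommGroup H'] [NormedSpace ℝ H'] (T : H →L[ℝ] H') (n : ℕ) (z : ℕ → H) :
    T (average n z) = average n fun i => T (z i) := by
  simp [average]

theorem average_sub_const {H : Type*} [AddCommGroup H] [Module ℝ H] {n : ℕ} (hn : n ≠ 0)
    (z : ℕ → H) (c : H) : (average n fun i => z i - c) = average n z - c := by
  rw [average, Finset.sum_sub_distrib, Finset.sum_const, Finset.card_range, smul_sub,
    ← Nat.cast_smul_eq_nsmul ℝ, smul_smul, inv_mul_cancel₀ (by exact_mod_cast hn), one_smul]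
  rfl

theorem average_tensor_sub (n : ℕ) (f g : ℕ → L2I) (c : L2I) :
    (average n fun i => tensor (f i) (g i - c)) =
      (average n fun i => tensor (f i) (g i)) - tensor (average n f) c := by
  simp only [average, tensor_sub_right, Finset.sum_sub_distrib, smul_sub, tensor_smul_left,
    tensor_sum_left]

/-- Replacing the sample mean by a fixed centre `c` makes the averaged terms independent when the
data are; the price is one rank-one correction. -/
theorem empCov_sub_eq {n : ℕ} (hn : n ≠ 0) (x : ℕ → L2I) (c : L2I) (K : L2I2) :
    empCov n x - K = (average n fun i => tensor (x i - c) (x i - c) - K) -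
      tensor (average n fun i => x i - c) (average n fun i => x i - c) := by
  have hu : sampleMean n x = c + average n fun i => x i - c := by
    rw [average_sub_const hn]
    change average n x = _
    abel
  set u := average n fun i => x i - c with hud
  have h1 : ∑ i ∈ Finset.range n, tensor (x i - sampleMean n x) (x i - sampleMean n x) =
      ∑ i ∈ Finset.range n, tensor (x i - c) (x i - sampleMean n x) := by
    have h2 : ∀ i, tensor (x i - sampleMean n x) (x i - sampleMean n x) =
        tensor (x i - c) (x i - sampleMean n x) - tensor u (x i - sampleMean n x) := by
      intro i
      rw [← tensor_sub_left]
      congr 1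
      rw [hu]; abel
    simp only [h2, Finset.sum_sub_distrib]
    rw [← tensor_sum_right, sum_sub_sampleMean hn]
    simpa using map_zero (tensorL u)
  have h3 : ∀ i, x i - sampleMean n x = (x i - c) - u := fun i => by rw [hu]; abel
  rw [average_sub_const hn, empCov, h1]
  simp only [h3]
  have h4 := average_tensor_sub n (fun i => x i - c) (fun i => x i - c) u
  rw [← hud] at h4
  change average n _ - K = _
  rw [h4]
  abel

/-- Cauchy–Schwarz with free weights `t`. The choice `t k = √(κ k)` matches the size of `√n ‖Δ
φ_k‖`, so that after taking expectations both factors are governed by `perturbationWeight`. -/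
theorem sum_mul_sq_le {s : Finset ℕ} {v g r t : ℕ → ℝ} (hv : ∀ k ∈ s, 0 ≤ v k)
    (hg : ∀ k ∈ s, 0 < g k) (ht : ∀ k ∈ s, 0 < t k) :
    (∑ k ∈ s, v k * (r k / g k)) ^ 2 ≤
      (∑ k ∈ s, v k * t k / g k) * ∑ k ∈ s, v k / (g k * t k) * r k ^ 2 := by
  refine Finset.sum_sq_le_sum_mul_sum_of_sq_le_mul s (fun k hk => ?_) (fun k hk => ?_)
    (fun k hk => ?_)
  · have := hv k hk; have := hg k hk; have := ht k hk
    positivity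
  · have := hv k hk; have := hg k hk; have := ht k hk
    positivity
  · have := (hg k hk).ne'; have := (ht k hk).ne'
    refine le_of_eq ?_
    field_simp

/-- The sum that controls the effect of estimating the first `m` eigenfunctions. -/
def perturbationWeight (b : L2I2) (κ : ℕ → ℝ) (φ : HilbertBasis ℕ ℝ L2I) (m : ℕ) : ℝ :=
  ∑ k ∈ Finset.range m, ‖op b (φ k)‖ * √(κ k) / (κ k - κ m)

/-- The right-hand side is free of `κ'` and `φ'`. The quarter-gap hypotheses give `‖Δ‖ ≤ g / 2`;
hence `‖Δ‖ ≤ ρ / 2`, and `κ k - κ' m` is at least half of `κ k - κ m` for `k < m`. The bounds by `1`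
reduce products of two averages to a single one. -/
theorem norm_sq_bHat_sub_le_of_good {n m : ℕ} (hn : n ≠ 0) (hm : m ≠ 0) {x y e : ℕ → L2I}
    {a c : L2I} {b K : L2I2} {κ κ' : ℕ → ℝ} {φ φ' : HilbertBasis ℕ ℝ L2I}
    (hK : IsSpectralExpansion K κ φ) (hκ : StrictAnti κ)
    (hK' : IsSpectralExpansion (empCov n x) κ' φ')
    (hy : ∀ i, y i = a + op b (x i - sampleMean n x) + e i) {D : L2I →L[ℝ] L2I}
    (hD : ∀ k x, inner ℝ (φ k) (D x) = (κ k + κ (m - 1))⁻¹ * inner ℝ (φ k) x)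
    (hΔ : ‖average n fun i => tensor (x i - c) (x i - c) - K‖ ≤ (κ (m - 1) - κ m) / 4)
    (hu4 : ‖average n fun i => x i - c‖ ^ 2 ≤ (κ (m - 1) - κ m) / 4)
    (hu1 : ‖average n fun i => x i - c‖ ^ 2 ≤ 1) (he1 : ‖average n e‖ ^ 2 ≤ 1) :
    ‖bHat n m x y κ' φ' - b‖ ^ 2 ≤
      40 * ‖average n fun i => tensor (e i) (D (x i - c))‖ ^ 2 +
      40 * ‖average n fun i => D (x i - c)‖ ^ 2 +
      16 * perturbationWeight b κ φ m * ∑ k ∈ Finset.range m,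
        ‖op b (φ k)‖ / ((κ k - κ m) * √(κ k)) *
          (‖average n fun i => op (tensor (x i - c) (x i - c) - K) (φ k)‖ ^ 2 +
            ‖average n fun i => (inner ℝ (φ k) (x i - c) : ℝ)‖ ^ 2) +
      2 * ‖b - truncKernel φ b m‖ ^ 2 := by
  have hpos : ∀ k, 0 < κ k := fun k => (hK.nonneg (k + 1)).trans_lt (hκ k.lt_succ_self)
  set ρ := κ (m - 1) with hρ
  set g := ρ - κ m with hg
  set u := average n fun i => x i - c with hu
  have hg0 : 0 < g := sub_pos.2 (hκ (by omega))
  have hgρ : g ≤ ρ := by have := hK.nonneg m; linarith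
  have hkg : ∀ k ∈ Finset.range m, g ≤ κ k - κ m := fun k hk => by
    have := hK.antitone (show k ≤ m - 1 by have := Finset.mem_range.1 hk; omega)
    linarith
  set Δ := empCov n x - K with hΔd
  have hΔeq := empCov_sub_eq hn x c K
  have hΔ2 : ‖Δ‖ ≤ g / 2 := by
    rw [hΔd, hΔeq]
    refine (norm_sub_le _ _).trans ?_
    rw [norm_tensor, ← sq]
    linarith
  have hmain := norm_sq_bHat_sub_le (m := m) hn hK hK' hy (hpos (m - 1))
    (fun k hk => hK.antitone (by omega)) (hΔ2.trans (by linarith)) hD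
  have htail := tsum_norm_op_tail_le φ φ' b m
  have hS : ‖(n : ℝ)⁻¹ • ∑ i ∈ Finset.range n, tensor (e i) (D (x i - sampleMean n x))‖ ^ 2 ≤
      2 * ‖average n fun i => tensor (e i) (D (x i - c))‖ ^ 2 +
      2 * ‖average n fun i => D (x i - c)‖ ^ 2 := by
    have h1 : ∀ i, D (x i - sampleMean n x) = D (x i - c) - D u := by
      intro i
      rw [← map_sub, hu, average_sub_const hn]
      change D (x i - average n x) = _
      congr 1; abel
    simp only [h1]
    change ‖average n _‖ ^ 2 ≤ _
    rw [average_tensor_sub]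
    refine (norm_sub_sq_le_two_mul _ _).trans ?_
    rw [norm_tensor, mul_pow, hu, map_average]
    have h2 := mul_le_mul_of_nonneg_right he1 (sq_nonneg ‖average n fun i => D (x i - c)‖)
    linarith
  have hκ'm : κ' m ≤ κ m + g / 2 := (hK.eigenvalue_le hK' m).trans (by linarith)
  have hres : ∀ k ∈ Finset.range m,
      ‖residual φ' m (φ k)‖ ≤ 2 * (‖op Δ (φ k)‖ / (κ k - κ m)) := by
    intro k hk
    have h1 := hkg k hk
    have h2 := norm_residual_mul_le hK hK' (k := k) (m := m) (by linarith)
    rw [mul_div_assoc', le_div_iff₀ (by linarith)]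
    nlinarith [norm_nonneg (residual φ' m (φ k))]
  have hop : ∀ k, ‖op Δ (φ k)‖ ^ 2 ≤
      2 * (‖average n fun i => op (tensor (x i - c) (x i - c) - K) (φ k)‖ ^ 2 +
        ‖average n fun i => (inner ℝ (φ k) (x i - c) : ℝ)‖ ^ 2) := by
    intro k
    rw [hΔd, hΔeq, map_sub, _root_.sub_apply, op_tensor]
    refine (norm_sub_sq_le_two_mul _ _).trans ?_
    have h1 := map_average (op.flip (φ k)) n fun i => tensor (x i - c) (x i - c) - K
    have h2 := map_average (innerSL ℝ (φ k)) n fun i => x i - c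
    simp only [ContinuousLinearMap.flip_apply, innerSL_apply_apply] at h1 h2
    rw [← h1, ← h2, norm_smul, mul_pow, real_inner_comm]
    have h3 := mul_le_mul_of_nonneg_left hu1
      (sq_nonneg ‖(inner ℝ (φ k) u : ℝ)‖)
    rw [mul_one] at h3
    rw [← hu]
    linarith
  have hV0 : 0 ≤ perturbationWeight b κ φ m := Finset.sum_nonneg fun k hk => by
    have := hkg k hk
    have : 0 < κ k - κ m := by linarith
    positivity
  have hsum : (∑ k ∈ Finset.range m, ‖op b (φ k)‖ * ‖residual φ' m (φ k)‖) ^ 2 ≤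
      8 * perturbationWeight b κ φ m * ∑ k ∈ Finset.range m,
        ‖op b (φ k)‖ / ((κ k - κ m) * √(κ k)) *
          (‖average n fun i => op (tensor (x i - c) (x i - c) - K) (φ k)‖ ^ 2 +
            ‖average n fun i => (inner ℝ (φ k) (x i - c) : ℝ)‖ ^ 2) := by
    calc _ ≤ (2 * ∑ k ∈ Finset.range m, ‖op b (φ k)‖ * (‖op Δ (φ k)‖ / (κ k - κ m))) ^ 2 := by
          rw [Finset.mul_sum]
          have : ∀ k ∈ Finset.range m, ‖op b (φ k)‖ * ‖residual φ' m (φ k)‖ ≤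
              2 * (‖op b (φ k)‖ * (‖op Δ (φ k)‖ / (κ k - κ m))) := fun k hk => by
            have h1 := mul_le_mul_of_nonneg_left (hres k hk) (norm_nonneg (op b (φ k)))
            linarith
          exact pow_le_pow_left₀ (Finset.sum_nonneg fun _ _ => by positivity)
            (Finset.sum_le_sum this) 2
      _ = 4 * (∑ k ∈ Finset.range m, ‖op b (φ k)‖ * (‖op Δ (φ k)‖ / (κ k - κ m))) ^ 2 := by ring
      _ ≤ 4 * (perturbationWeight b κ φ m * ∑ k ∈ Finset.range m,
            ‖op b (φ k)‖ / ((κ k - κ m) * √(κ k)) * ‖op Δ (φ k)‖ ^ 2) := by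
          gcongr
          exact sum_mul_sq_le (fun _ _ => norm_nonneg _) (fun k hk => by linarith [hkg k hk])
            (fun k _ => Real.sqrt_pos.2 (hpos k))
      _ ≤ 4 * (perturbationWeight b κ φ m * ∑ k ∈ Finset.range m,
            ‖op b (φ k)‖ / ((κ k - κ m) * √(κ k)) *
            (2 * (‖average n fun i => op (tensor (x i - c) (x i - c) - K) (φ k)‖ ^ 2 +
              ‖average n fun i => (inner ℝ (φ k) (x i - c) : ℝ)‖ ^ 2))) := by
          gcongr with k hk
          · have := hkg k hk
            have : 0 < κ k - κ m := by linarith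
            positivity
          · exact hop k
      _ = _ := by
          simp only [mul_left_comm _ (2 : ℝ), ← Finset.mul_sum]
          ring
  linarith

/-! ### Second moments of the averages in the error bound -/

section Expectation

variable {Ω : Type*} [mΩ : MeasurableSpace Ω] {P : Measure Ω} [IsProbabilityMeasure P]
  {X Y : Ω → L2I} {Xs Ys : ℕ → Ω → L2I} {κ : ℕ → ℝ} {φ : HilbertBasis ℕ ℝ L2I} {C₁ : ℝ}

theorem integral_average_center_sq
    (hindep : iIndepFun (fun i ω => (Xs i ω, Ys i ω)) P)
    (hident : ∀ i, IdentDistrib (fun ω => (Xs i ω, Ys i ω)) (fun ω => (X ω, Y ω)) P P)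
    (hX2 : MemLp X 2 P) {H : Type*} [NormedAddCommGroup H] [InnerProductSpace ℝ H]
    [CompleteSpace H] [SecondCountableTopology H] (T : L2I →L[ℝ] H) {n : ℕ} (hn : n ≠ 0) :
    Integrable (fun ω => ‖average n fun i => T (Xs i ω - ∫ ω', X ω' ∂P)‖ ^ 2) P ∧
    ∫ ω, ‖average n fun i => T (Xs i ω - ∫ ω', X ω' ∂P)‖ ^ 2 ∂P =
      (n : ℝ)⁻¹ * ∫ ω, ‖T (X ω - ∫ ω', X ω' ∂P)‖ ^ 2 ∂P := by
  refine integral_norm_sq_mean_copies hindep hident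
    (F := fun z => T (z.1 - ∫ ω', X ω' ∂P)) (by fun_prop) (T.comp_memLp' (memLp_center hX2)) ?_ hn
  rw [T.integral_comp_comm ((memLp_center hX2).integrable one_le_two), integral_center hX2, map_zero]

theorem memLp_tensor_center_sub (hX2 : MemLp X 2 P)
    (h4 : Integrable (fun ω => ‖X ω - ∫ ω', X ω' ∂P‖ ^ 4) P) (K : L2I2) :
    MemLp (fun ω => tensor (X ω - ∫ ω', X ω' ∂P) (X ω - ∫ ω', X ω' ∂P) - K) 2 P := by
  refine MemLp.sub ?_ (memLp_const K)
  rw [memLp_two_iff_integrable_sq_norm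
    (aestronglyMeasurable_tensor (memLp_center hX2).1 (memLp_center hX2).1)]
  refine h4.congr (Eventually.of_forall fun ω => ?_)
  simp only [norm_tensor]
  ring

/-- `T` is the identity for the probability of the good event and evaluation at `φ k` for the
perturbation term. -/
theorem integral_average_covariance_sq_le
    (hindep : iIndepFun (fun i ω => (Xs i ω, Ys i ω)) P)
    (hident : ∀ i, IdentDistrib (fun ω => (Xs i ω, Ys i ω)) (fun ω => (X ω, Y ω)) P P)
    (hX2 : MemLp X 2 P) (h4 : Integrable (fun ω => ‖X ω - ∫ ω', X ω' ∂P‖ ^ 4) P)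
    {H : Type*} [NormedAddCommGroup H] [InnerProductSpace ℝ H]
    [CompleteSpace H] [SecondCountableTopology H] (T : L2I2 →L[ℝ] H) {n : ℕ} (hn : n ≠ 0) :
    Integrable (fun ω => ‖average n fun i => T (tensor (Xs i ω - ∫ ω', X ω' ∂P)
      (Xs i ω - ∫ ω', X ω' ∂P) - covFun P X)‖ ^ 2) P ∧
    ∫ ω, ‖average n fun i => T (tensor (Xs i ω - ∫ ω', X ω' ∂P)
      (Xs i ω - ∫ ω', X ω' ∂P) - covFun P X)‖ ^ 2 ∂P ≤
      (n : ℝ)⁻¹ * (2 * ∫ ω, ‖T (tensor (X ω - ∫ ω', X ω' ∂P) (X ω - ∫ ω', X ω' ∂P))‖ ^ 2 ∂P +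
        2 * ‖T (covFun P X)‖ ^ 2) := by
  have hmem := memLp_tensor_center_sub hX2 h4 (covFun P X)
  have hF : Continuous fun z : L2I × L2I =>
      T (tensor (z.1 - ∫ ω', X ω' ∂P) (z.1 - ∫ ω', X ω' ∂P) - covFun P X) := by
    refine T.continuous.comp (Continuous.sub ?_ continuous_const)
    exact continuous_tensor.comp
      ((continuous_fst.sub continuous_const).prodMk (continuous_fst.sub continuous_const))
  have hmean : ∫ ω, T (tensor (X ω - ∫ ω', X ω' ∂P) (X ω - ∫ ω', X ω' ∂P) - covFun P X) ∂P = 0 := by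
    rw [T.integral_comp_comm (hmem.integrable one_le_two),
      integral_sub (integrable_tensor_center hX2) (integrable_const _)]
    simp [covFun]
  obtain ⟨hi, he⟩ := integral_norm_sq_mean_copies hindep hident hF (T.comp_memLp' hmem) hmean hn
  refine ⟨hi, he.trans_le ?_⟩
  have h0 : MemLp (fun ω => tensor (X ω - ∫ ω', X ω' ∂P) (X ω - ∫ ω', X ω' ∂P)) 2 P := by
    simpa using memLp_tensor_center_sub hX2 h4 0
  have hT : Integrable (fun ω => ‖T (tensor (X ω - ∫ ω', X ω' ∂P)
      (X ω - ∫ ω', X ω' ∂P))‖ ^ 2) P := (T.comp_memLp' h0).integrable_norm_pow two_ne_zero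
  have hbound : Integrable (fun ω => 2 * ‖T (tensor (X ω - ∫ ω', X ω' ∂P)
      (X ω - ∫ ω', X ω' ∂P))‖ ^ 2 + 2 * ‖T (covFun P X)‖ ^ 2) P :=
    (hT.const_mul 2).add (integrable_const _)
  gcongr
  refine (integral_mono ((T.comp_memLp' hmem).integrable_norm_pow two_ne_zero) hbound
    fun ω => ?_).trans_eq ?_
  · simp only [Function.comp_apply, map_sub]
    exact norm_sub_sq_le_two_mul _ _
  · rw [integral_add (hT.const_mul 2) (integrable_const _), integral_const_mul]
    simp

theorem integral_average_noise_tensor_sq_le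
    (hindep : iIndepFun (fun i ω => (Xs i ω, Ys i ω)) P)
    (hident : ∀ i, IdentDistrib (fun ω => (Xs i ω, Ys i ω)) (fun ω => (X ω, Y ω)) P P)
    (hX : Measurable X) (hX2 : MemLp X 2 P) (hY2 : MemLp Y 2 P) {b : L2I2}
    (hmodel : FunctionalLinearModel P X Y b) (hC : 0 ≤ C₁)
    (hE : ∀ᵐ ω ∂P, condErrorVar P X Y ω ≤ C₁) (φ : HilbertBasis ℕ ℝ L2I) (D : L2I →L[ℝ] L2I)
    {n : ℕ} (hn : n ≠ 0) :
    Integrable (fun ω => ‖average n fun i =>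
      tensor (noise P X Y b (Xs i ω, Ys i ω)) (D (Xs i ω - ∫ ω', X ω' ∂P))‖ ^ 2) P ∧
    ∫ ω, ‖average n fun i =>
      tensor (noise P X Y b (Xs i ω, Ys i ω)) (D (Xs i ω - ∫ ω', X ω' ∂P))‖ ^ 2 ∂P ≤
      (n : ℝ)⁻¹ * (C₁ * ∫ ω, ‖D (X ω - ∫ ω', X ω' ∂P)‖ ^ 2 ∂P) := by
  have hDU : MemLp (fun ω => D (X ω - ∫ ω', X ω' ∂P)) 2 P := D.comp_memLp' (memLp_center hX2)
  have hN := memLp_noise hX2 hY2 b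
  have hsq := integral_noise_sq_mul_le hX hX2 hY2 hmodel hC hE
    (ζ := fun x => ‖D (x - ∫ ω', X ω' ∂P)‖ ^ 2) (by fun_prop) (fun _ => sq_nonneg _)
    (hDU.integrable_norm_pow two_ne_zero)
  have hm : AEStronglyMeasurable (fun ω => tensor (noise P X Y b (X ω, Y ω))
      (D (X ω - ∫ ω', X ω' ∂P))) P := aestronglyMeasurable_tensor hN.1 hDU.1
  have hmem : MemLp (fun ω => tensor (noise P X Y b (X ω, Y ω)) (D (X ω - ∫ ω', X ω' ∂P))) 2 P := by
    rw [memLp_two_iff_integrable_sq_norm hm]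
    refine hsq.1.congr (Eventually.of_forall fun ω => ?_)
    simp only [norm_tensor, mul_pow]
  have hF : Continuous fun z : L2I × L2I =>
      tensor (noise P X Y b z) (D (z.1 - ∫ ω', X ω' ∂P)) :=
    continuous_tensor.comp ((continuous_noise P X Y b).prodMk
      (D.continuous.comp (continuous_fst.sub continuous_const)))
  -- Applied to a basis vector, the tensor becomes a function of `X` times the noise, which has mean
  -- zero.
  have hmean : ∫ ω, tensor (noise P X Y b (X ω, Y ω)) (D (X ω - ∫ ω', X ω' ∂P)) ∂P = 0 := by
    refine eq_zero_of_op_eq_zero φ _ fun k => ?_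
    rw [← ContinuousLinearMap.flip_apply,
      ← (op.flip (φ k)).integral_comp_comm (hmem.integrable one_le_two)]
    simp only [ContinuousLinearMap.flip_apply, op_tensor]
    exact integral_smul_noise hX hX2 hY2 hmodel
      (ζ := fun x => inner ℝ (D (x - ∫ ω', X ω' ∂P)) (φ k)) (by fun_prop) (hDU.inner_const _)
  obtain ⟨hi, he⟩ := integral_norm_sq_mean_copies hindep hident hF hmem hmean hn
  refine ⟨hi, he.trans_le ?_⟩
  gcongr
  refine le_of_eq_of_le (integral_congr_ae (Eventually.of_forall fun ω => ?_)) hsq.2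
  simp only [norm_tensor, mul_pow]

theorem integral_average_noise_sq
    (hindep : iIndepFun (fun i ω => (Xs i ω, Ys i ω)) P)
    (hident : ∀ i, IdentDistrib (fun ω => (Xs i ω, Ys i ω)) (fun ω => (X ω, Y ω)) P P)
    (hX : Measurable X) (hX2 : MemLp X 2 P) (hY2 : MemLp Y 2 P) {b : L2I2}
    (hmodel : FunctionalLinearModel P X Y b) {n : ℕ} (hn : n ≠ 0) :
    Integrable (fun ω => ‖average n fun i => noise P X Y b (Xs i ω, Ys i ω)‖ ^ 2) P ∧
    ∫ ω, ‖average n fun i => noise P X Y b (Xs i ω, Ys i ω)‖ ^ 2 ∂P =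
      (n : ℝ)⁻¹ * ∫ ω, ‖noise P X Y b (X ω, Y ω)‖ ^ 2 ∂P :=
  integral_norm_sq_mean_copies hindep hident (continuous_noise P X Y b) (memLp_noise hX2 hY2 b)
    (integral_noise hX hX2 hY2 hmodel) hn

end Expectation

/-! ### Stochastic order and Markov's inequality -/

section BigOP

variable {Ω : Type*} [mΩ : MeasurableSpace Ω] {P : Measure Ω}

theorem IsBigOP.mono_rate {Z : ℕ → Ω → ℝ} {a a' : ℕ → ℝ} {c : ℝ} (hc : 0 < c)
    (h : IsBigOP P Z a) (ha : ∀ᶠ n in atTop, a n ≤ c * a' n) : IsBigOP P Z a' := by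
  intro ε hε
  obtain ⟨M, hM, hn⟩ := h ε hε
  refine ⟨M * c, by positivity, ?_⟩
  filter_upwards [hn, ha] with n h1 h2
  refine (measure_mono fun ω hω => ?_).trans h1
  have h3 : M * c * a' n < |Z n ω| := hω
  have h4 := mul_le_mul_of_nonneg_left h2 hM.le
  change M * a n < |Z n ω|
  linarith

variable [IsProbabilityMeasure P]

theorem measure_ge_le_ofReal {Z : Ω → ℝ} (hZ : Integrable Z P) (h0 : ∀ ω, 0 ≤ Z ω) {t : ℝ}
    (ht : 0 < t) : P {ω | t ≤ Z ω} ≤ ENNReal.ofReal ((∫ ω, Z ω ∂P) / t) := by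
  have h1 := mul_meas_ge_le_integral_of_nonneg (Eventually.of_forall h0) hZ t
  rw [← ofReal_measureReal]
  refine ENNReal.ofReal_le_ofReal ?_
  rwa [le_div_iff₀ ht, mul_comm]

theorem tendsto_measure_ge_zero {Z : ℕ → Ω → ℝ} {t : ℕ → ℝ} {c : ℝ}
    (hZ : ∀ᶠ n in atTop, Integrable (Z n) P ∧ (∀ ω, 0 ≤ Z n ω) ∧
      ∫ ω, Z n ω ∂P ≤ (n : ℝ)⁻¹ * c)
    (ht : ∀ᶠ n in atTop, 0 < t n) (hnt : Tendsto (fun n : ℕ => (n : ℝ) * t n) atTop atTop) :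
    Tendsto (fun n => P {ω | t n ≤ Z n ω}) atTop (𝓝 0) := by
  have h1 : Tendsto (fun n : ℕ => ENNReal.ofReal (c / ((n : ℝ) * t n))) atTop (𝓝 0) := by
    have := ENNReal.tendsto_ofReal (hnt.const_div_atTop c)
    rwa [ENNReal.ofReal_zero] at this
  refine tendsto_of_tendsto_of_tendsto_of_le_of_le' tendsto_const_nhds h1
    (Eventually.of_forall fun _ => zero_le) ?_
  filter_upwards [hZ, ht, eventually_gt_atTop 0] with n h2 h3 h4
  refine (measure_ge_le_ofReal h2.1 h2.2.1 h3).trans (ENNReal.ofReal_le_ofReal ?_)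
  have h5 : (0 : ℝ) < n := by exact_mod_cast h4
  calc _ ≤ ((n : ℝ)⁻¹ * c) / t n := by gcongr; exact h2.2.2
    _ = _ := by field_simp

theorem isBigOP_of_good_event {Z T : ℕ → Ω → ℝ} {a : ℕ → ℝ} {B : ℕ → Set Ω} {c : ℝ} (hc : 0 < c)
    (hB : Tendsto (fun n => P (B n)) atTop (𝓝 0))
    (h : ∀ᶠ n in atTop, 0 < a n ∧ Integrable (T n) P ∧ (∀ ω, 0 ≤ T n ω) ∧
      ∫ ω, T n ω ∂P ≤ c * a n ∧ ∀ ω ∉ B n, |Z n ω| ≤ T n ω + c * a n) :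
    IsBigOP P Z a := by
  intro ε hε
  -- `2 * c / ε` makes Markov's bound for `T n` equal to `ε / 2`; the extra `c` absorbs the
  -- deterministic term.
  refine ⟨2 * c / ε + c, by positivity, ?_⟩
  have hB' : ∀ᶠ n in atTop, P (B n) ≤ ENNReal.ofReal (ε / 2) :=
    (hB.eventually_lt_const (ENNReal.ofReal_pos.2 (half_pos hε))).mono fun n hn => hn.le
  filter_upwards [hB', h] with n h1 ⟨ha, hT, hT0, hTi, hZ⟩
  have hsub : {ω | (2 * c / ε + c) * a n < |Z n ω|} ⊆ B n ∪ {ω | 2 * c / ε * a n ≤ T n ω} := by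
    intro ω hω
    by_cases hωB : ω ∈ B n
    · exact Or.inl hωB
    · refine Or.inr ?_
      have h2 := hZ ω hωB
      have h3 : (2 * c / ε + c) * a n < |Z n ω| := hω
      change 2 * c / ε * a n ≤ T n ω
      linarith
  calc _ ≤ P (B n) + P {ω | 2 * c / ε * a n ≤ T n ω} :=
        (measure_mono hsub).trans (measure_union_le _ _)
    _ ≤ ENNReal.ofReal (ε / 2) + ENNReal.ofReal (ε / 2) := by
        refine add_le_add h1 ?_
        refine (measure_ge_le_ofReal hT hT0 (by positivity)).trans (ENNReal.ofReal_le_ofReal ?_)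
        rw [div_le_iff₀ (by positivity)]
        refine hTi.trans_eq ?_
        field_simp
    _ = _ := by rw [← ENNReal.ofReal_add (by positivity) (by positivity), add_halves]

end BigOP

/-! ### Decay of the slope: bias and perturbation weight -/

section Slope

variable {b : L2I2} {κ : ℕ → ℝ} {φ : HilbertBasis ℕ ℝ L2I} {α β γ C₁ : ℝ}

/-- Parseval in the first argument. Only here is `γ` used: it affects the constant, not the decay in
`k`. -/
theorem norm_op_sq_le (hγ : 1 / 2 < γ)
    (hb : ∀ j k : ℕ, |coef φ b j k| ≤ C₁ * ((j : ℝ) + 1) ^ (-γ) * ((k : ℝ) + 1) ^ (-β)) (k : ℕ) :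
    ‖op b (φ k)‖ ^ 2 ≤
      (C₁ ^ 2 * ∑' j : ℕ, ((j : ℝ) + 1) ^ (-(2 * γ))) * ((k : ℝ) + 1) ^ (-(2 * β)) := by
  have hs := summable_succ_rpow_neg (show 1 < 2 * γ by linarith)
  have h1 := (hs.hasSum.mul_left (C₁ ^ 2)).mul_right (((k : ℝ) + 1) ^ (-(2 * β)))
  refine hasSum_le (fun j => ?_) (hasSum_inner_sq φ (op b (φ k))) h1
  rw [← coef_eq_inner, ← sq_abs]
  have hsq : ∀ (i : ℕ) (p : ℝ), (((i : ℝ) + 1) ^ (-p)) ^ 2 = ((i : ℝ) + 1) ^ (-(2 * p)) := by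
    intro i p
    rw [← Real.rpow_natCast, ← Real.rpow_mul (by positivity)]
    congr 1; push_cast; ring
  calc |coef φ b j k| ^ 2 ≤ (C₁ * ((j : ℝ) + 1) ^ (-γ) * ((k : ℝ) + 1) ^ (-β)) ^ 2 :=
        pow_le_pow_left₀ (abs_nonneg _) (hb j k) 2
    _ = _ := by rw [mul_pow, mul_pow, hsq, hsq]

theorem norm_sub_truncKernel_sq_le {G : ℝ} (hβ : 1 / 2 < β) (hG : 0 ≤ G)
    (hv : ∀ k : ℕ, ‖op b (φ k)‖ ^ 2 ≤ G * ((k : ℝ) + 1) ^ (-(2 * β))) {m : ℕ} (hm : 1 ≤ m) :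
    ‖b - truncKernel φ b m‖ ^ 2 ≤ G * (2 * β - 1)⁻¹ * (m : ℝ) ^ (-2 * β + 1) := by
  have hs := hasSum_norm_sub_truncKernel φ b m
  have hs' := (summable_nat_add_iff m).2 (summable_succ_rpow_neg (show 1 < 2 * β by linarith))
  rw [← hs.tsum_eq]
  calc _ ≤ ∑' k : ℕ, G * (((k + m : ℕ) : ℝ) + 1) ^ (-(2 * β)) :=
        hs.summable.tsum_le_tsum (fun k => hv (k + m)) (hs'.mul_left G)
    _ = G * ∑' k : ℕ, (((k + m : ℕ) : ℝ) + 1) ^ (-(2 * β)) := tsum_mul_left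
    _ ≤ G * ((2 * β - 1)⁻¹ * (m : ℝ) ^ (1 - 2 * β)) := by
        gcongr
        exact tsum_rpow_neg_tail_le (by linarith) hm
    _ = _ := by rw [mul_assoc]; congr 3; ring

/-- The powers of `k + 1` combine to exponent `-β - α / 2 + α = -(β - α / 2)`, which is below `-1`
exactly by the condition on `β`; `sum_rpow_neg_mul_div_le` then handles the gaps near `k = m`. -/
theorem exists_perturbationWeight_le {G : ℝ} (hα : 1 < α) (hβ : α / 2 + 1 < β) (hC₁ : 0 < C₁)
    (hG : 0 ≤ G) (hv : ∀ k : ℕ, ‖op b (φ k)‖ ^ 2 ≤ G * ((k : ℝ) + 1) ^ (-(2 * β)))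
    (hκ : ∀ k : ℕ, κ k ≤ C₁ * ((k : ℝ) + 1) ^ (-α))
    (hgap : ∀ k : ℕ, C₁⁻¹ * ((k : ℝ) + 1) ^ (-α - 1) ≤ κ k - κ (k + 1)) :
    ∃ V : ℝ, ∀ m, perturbationWeight b κ φ m ≤ V := by
  have hq : 1 < β - α / 2 := by linarith
  refine ⟨√G * √C₁ * (C₁ * α) * (3 * ∑' k : ℕ, ((k : ℝ) + 1) ^ (-(β - α / 2))), fun m => ?_⟩
  refine le_trans ?_ (mul_le_mul_of_nonneg_left (sum_rpow_neg_mul_div_le hq m) (by positivity))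
  rw [perturbationWeight, Finset.mul_sum]
  refine Finset.sum_le_sum fun k hk => ?_
  have hkm := Finset.mem_range.1 hk
  have hd : (0 : ℝ) < (m : ℝ) - k := sub_pos.2 (by exact_mod_cast hkm)
  set A : ℝ := (k : ℝ) + 1 with hA
  have hA0 : 0 < A := by positivity
  have hsqrt : ∀ p : ℝ, √(A ^ (-p)) = A ^ (-(p / 2)) := by
    intro p
    rw [Real.sqrt_eq_rpow, ← Real.rpow_mul hA0.le]
    congr 1; ring
  have h1 : ‖op b (φ k)‖ ≤ √G * A ^ (-β) := by
    have := Real.le_sqrt_of_sq_le (hv k)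
    rw [Real.sqrt_mul hG, hsqrt] at this
    rwa [mul_div_cancel_left₀ _ (two_ne_zero)] at this
  have h2 : √(κ k) ≤ √C₁ * A ^ (-(α / 2)) := by
    have := Real.sqrt_le_sqrt (hκ k)
    rwa [Real.sqrt_mul hC₁.le, hsqrt] at this
  have h3 := eigenvalue_sub_ge_mul hα hC₁ hgap hkm.le
  have hAα : 0 < A ^ (-α) := Real.rpow_pos_of_pos hA0 _
  have h4 : 0 < (C₁ * α)⁻¹ * A ^ (-α) * (((m : ℝ) - k) / (m + 1)) := by positivity
  calc _ ≤ (√G * A ^ (-β)) * (√C₁ * A ^ (-(α / 2))) /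
        ((C₁ * α)⁻¹ * A ^ (-α) * (((m : ℝ) - k) / (m + 1))) := by gcongr
    _ = √G * √C₁ * (C₁ * α) * ((A ^ (-β) * A ^ (-(α / 2)) / A ^ (-α)) * (((m : ℝ) + 1) / (m - k))) := by
        field_simp
    _ = _ := by
        rw [← Real.rpow_add hA0, ← Real.rpow_sub hA0]
        congr 4; ring

end Slope

/-! ### Expectation of the random part of the error -/

section ErrorBound

variable {Ω : Type*} [mΩ : MeasurableSpace Ω] {P : Measure Ω}

/-- A bound for the random part of the estimation error. -/
def errorBound (P : Measure Ω) (X Y : Ω → L2I) (b : L2I2) (κ : ℕ → ℝ) (φ : HilbertBasis ℕ ℝ L2I)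
    (D : L2I →L[ℝ] L2I) (n m : ℕ) (x y : ℕ → L2I) : ℝ :=
  40 * ‖average n fun i => tensor (noise P X Y b (x i, y i)) (D (x i - ∫ ω, X ω ∂P))‖ ^ 2 +
  40 * ‖average n fun i => D (x i - ∫ ω, X ω ∂P)‖ ^ 2 +
  16 * perturbationWeight b κ φ m * ∑ k ∈ Finset.range m,
    ‖op b (φ k)‖ / ((κ k - κ m) * √(κ k)) *
      (‖average n fun i =>
        op (tensor (x i - ∫ ω, X ω ∂P) (x i - ∫ ω, X ω ∂P) - covFun P X) (φ k)‖ ^ 2 +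
        ‖average n fun i => (inner ℝ (φ k) (x i - ∫ ω, X ω ∂P) : ℝ)‖ ^ 2)

theorem perturbationWeight_nonneg (b : L2I2) {κ : ℕ → ℝ} (φ : HilbertBasis ℕ ℝ L2I)
    (hκ : Antitone κ) (m : ℕ) : 0 ≤ perturbationWeight b κ φ m :=
  Finset.sum_nonneg fun k hk => by
    have : 0 ≤ κ k - κ m := sub_nonneg.2 (hκ (Finset.mem_range.1 hk).le)
    positivity

theorem errorBound_nonneg (X Y : Ω → L2I) (b : L2I2) {κ : ℕ → ℝ} (φ : HilbertBasis ℕ ℝ L2I)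
    (hκ : Antitone κ) (D : L2I →L[ℝ] L2I) (n m : ℕ) (x y : ℕ → L2I) :
    0 ≤ errorBound P X Y b κ φ D n m x y := by
  have h1 := perturbationWeight_nonneg b φ hκ m
  have h2 : 0 ≤ ∑ k ∈ Finset.range m, ‖op b (φ k)‖ / ((κ k - κ m) * √(κ k)) *
      (‖average n fun i =>
        op (tensor (x i - ∫ ω, X ω ∂P) (x i - ∫ ω, X ω ∂P) - covFun P X) (φ k)‖ ^ 2 +
        ‖average n fun i => (inner ℝ (φ k) (x i - ∫ ω, X ω ∂P) : ℝ)‖ ^ 2) :=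
    Finset.sum_nonneg fun k hk => by
      have : 0 ≤ κ k - κ m := sub_nonneg.2 (hκ (Finset.mem_range.1 hk).le)
      positivity
  unfold errorBound
  positivity

variable [IsProbabilityMeasure P]
  {X Y : Ω → L2I} {Xs Ys : ℕ → Ω → L2I} {κ : ℕ → ℝ} {φ : HilbertBasis ℕ ℝ L2I} {C₁ : ℝ}

/-- The essential point is the factor `κ k`. It comes from `E (‖X - E X‖² ξ_k²)`, while the centring
term `κ k ^ 2` is absorbed by `κ k ≤ C₁`. -/
theorem integral_average_op_sq_le
    (hindep : iIndepFun (fun i ω => (Xs i ω, Ys i ω)) P)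
    (hident : ∀ i, IdentDistrib (fun ω => (Xs i ω, Ys i ω)) (fun ω => (X ω, Y ω)) P P)
    (hX2 : MemLp X 2 P) (hK : IsSpectralExpansion (covFun P X) κ φ) (hpos : ∀ k, 0 < κ k)
    (hs : Summable κ) (hκC : ∀ k, κ k ≤ C₁)
    (hξ : ∀ k, MemLp (score P X φ k) 4 P ∧ ∫ ω, score P X φ k ω ^ 4 ∂P ≤ C₁ * κ k ^ 2)
    {n : ℕ} (hn : n ≠ 0) (k : ℕ) :
    Integrable (fun ω => ‖average n fun i => op (tensor (Xs i ω - ∫ ω', X ω' ∂P)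
      (Xs i ω - ∫ ω', X ω' ∂P) - covFun P X) (φ k)‖ ^ 2) P ∧
    ∫ ω, ‖average n fun i => op (tensor (Xs i ω - ∫ ω', X ω' ∂P)
      (Xs i ω - ∫ ω', X ω' ∂P) - covFun P X) (φ k)‖ ^ 2 ∂P ≤
      (n : ℝ)⁻¹ * ((2 * C₁ * (∑' j, κ j) + 2 * C₁) * κ k) := by
  obtain ⟨hi, he⟩ := integral_average_covariance_sq_le hindep hident hX2
    (integral_norm_center_pow_four hX2 hpos hs hξ).1 (op.flip (φ k)) hn
  refine ⟨hi, he.trans ?_⟩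
  simp only [ContinuousLinearMap.flip_apply, op_tensor, hK.op_apply, norm_smul, φ.orthonormal.1,
    mul_one, mul_pow, real_inner_comm (φ k)]
  have h1 : ∀ ω, ‖(inner ℝ (φ k) (X ω - ∫ ω', X ω' ∂P) : ℝ)‖ ^ 2 * ‖X ω - ∫ ω', X ω' ∂P‖ ^ 2 =
      ‖X ω - ∫ ω', X ω' ∂P‖ ^ 2 * score P X φ k ω ^ 2 := fun ω => by
    rw [score_eq_inner, Real.norm_eq_abs, sq_abs, mul_comm]
  simp only [h1]
  have h2 := (integral_norm_center_sq_mul hX2 hpos hs hξ k).2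
  have h3 := mul_le_mul_of_nonneg_right (hκC k) (hpos k).le
  rw [Real.norm_eq_abs, sq_abs]
  gcongr
  linarith

theorem integral_errorBound_le
    (hindep : iIndepFun (fun i ω => (Xs i ω, Ys i ω)) P)
    (hident : ∀ i, IdentDistrib (fun ω => (Xs i ω, Ys i ω)) (fun ω => (X ω, Y ω)) P P)
    (hX : Measurable X) (hX2 : MemLp X 2 P) (hY2 : MemLp Y 2 P) {b : L2I2}
    (hmodel : FunctionalLinearModel P X Y b) (hK : IsSpectralExpansion (covFun P X) κ φ)
    (hC : 0 ≤ C₁) (hE : ∀ᵐ ω ∂P, condErrorVar P X Y ω ≤ C₁)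
    (hpos : ∀ k, 0 < κ k) (hs : Summable κ) (hκC : ∀ k, κ k ≤ C₁)
    (hξ : ∀ k, MemLp (score P X φ k) 4 P ∧ ∫ ω, score P X φ k ω ^ 4 ∂P ≤ C₁ * κ k ^ 2)
    {D : L2I →L[ℝ] L2I} {d : ℕ → ℝ} (hD : ∀ k x, inner ℝ (φ k) (D x) = d k * inner ℝ (φ k) x)
    {A V : ℝ} (hds : Summable fun k => d k ^ 2 * κ k) (hA : ∑' k, d k ^ 2 * κ k ≤ A) {m : ℕ}
    (hV : perturbationWeight b κ φ m ≤ V) {n : ℕ} (hn : n ≠ 0) :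
    Integrable (fun ω => errorBound P X Y b κ φ D n m (fun i => Xs i ω) (fun i => Ys i ω)) P ∧
    ∫ ω, errorBound P X Y b κ φ D n m (fun i => Xs i ω) (fun i => Ys i ω) ∂P ≤
      (n : ℝ)⁻¹ * (40 * (C₁ + 1) * A + 16 * (2 * C₁ * (∑' j, κ j) + 2 * C₁ + 1) * V ^ 2) := by
  have hDU := integral_norm_diag_center_sq hX2 hK hD hds
  obtain ⟨i1, e1⟩ := integral_average_noise_tensor_sq_le hindep hident hX hX2 hY2 hmodel hC hE φ D hn
  obtain ⟨i2, e2⟩ := integral_average_center_sq hindep hident hX2 D hn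
  have h3 := integral_average_op_sq_le hindep hident hX2 hK hpos hs hκC hξ hn
  have h4 : ∀ k, Integrable (fun ω => ‖average n fun i =>
        (inner ℝ (φ k) (Xs i ω - ∫ ω', X ω' ∂P) : ℝ)‖ ^ 2) P ∧
      ∫ ω, ‖average n fun i => (inner ℝ (φ k) (Xs i ω - ∫ ω', X ω' ∂P) : ℝ)‖ ^ 2 ∂P =
        (n : ℝ)⁻¹ * κ k := by
    intro k
    obtain ⟨h5, h6⟩ := integral_average_center_sq hindep hident hX2 (innerSL ℝ (φ k)) hn
    refine ⟨h5, h6.trans ?_⟩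
    rw [← integral_score_sq hX2 hK k]
    congr 2
    ext ω
    rw [score_eq_inner, innerSL_apply_apply, Real.norm_eq_abs, sq_abs]
  set V' := perturbationWeight b κ φ m with hV'
  have hV0 : 0 ≤ V' := perturbationWeight_nonneg b φ hK.antitone m
  set w : ℕ → ℝ := fun k => ‖op b (φ k)‖ / ((κ k - κ m) * √(κ k)) with hw
  have hw0 : ∀ k ∈ Finset.range m, 0 ≤ w k := fun k hk => by
    have : 0 ≤ κ k - κ m := sub_nonneg.2 (hK.antitone (Finset.mem_range.1 hk).le)
    positivity
  -- The Cauchy–Schwarz weights against variances of order `κ k / n` give the perturbation weight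
  -- again, so this part costs `V' ^ 2 / n`.
  have hwκ : ∑ k ∈ Finset.range m, w k * κ k = V' := by
    rw [hV', perturbationWeight]
    refine Finset.sum_congr rfl fun k _ => ?_
    have h5 : √(κ k) ≠ 0 := (Real.sqrt_pos.2 (hpos k)).ne'
    conv_lhs => rw [← Real.mul_self_sqrt (hpos k).le]
    simp only [hw]
    rcases eq_or_ne (κ k - κ m) 0 with h0 | h0
    · simp [h0]
    · field_simp
  have i3 : ∀ k ∈ Finset.range m, Integrable (fun ω => w k * (‖average n fun i => op (tensor
      (Xs i ω - ∫ ω', X ω' ∂P) (Xs i ω - ∫ ω', X ω' ∂P) - covFun P X) (φ k)‖ ^ 2 +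
        ‖average n fun i => (inner ℝ (φ k) (Xs i ω - ∫ ω', X ω' ∂P) : ℝ)‖ ^ 2)) P :=
    fun k _ => ((h3 k).1.add (h4 k).1).const_mul _
  refine ⟨((i1.const_mul 40).add (i2.const_mul 40)).add
    ((integrable_finsetSum _ i3).const_mul (16 * V')), ?_⟩
  have hlin : ∀ {f g h : Ω → ℝ} (c : ℝ), Integrable f P → Integrable g P → Integrable h P →
      ∫ ω, (40 * f ω + 40 * g ω + c * h ω) ∂P =
        40 * ∫ ω, f ω ∂P + 40 * ∫ ω, g ω ∂P + c * ∫ ω, h ω ∂P := by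
    intro f g h c hf hg hh
    have hfg : Integrable (fun ω => 40 * f ω + 40 * g ω) P := (hf.const_mul 40).add (hg.const_mul 40)
    rw [integral_add hfg (hh.const_mul c),
      integral_add (hf.const_mul 40) (hg.const_mul 40), integral_const_mul, integral_const_mul,
      integral_const_mul]
  refine le_of_eq_of_le (hlin (16 * V') i1 i2 (integrable_finsetSum _ i3)) ?_
  rw [integral_finsetSum _ i3]
  have h5 : ∑ k ∈ Finset.range m, ∫ ω, w k * (‖average n fun i => op (tensor
      (Xs i ω - ∫ ω', X ω' ∂P) (Xs i ω - ∫ ω', X ω' ∂P) - covFun P X) (φ k)‖ ^ 2 +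
        ‖average n fun i => (inner ℝ (φ k) (Xs i ω - ∫ ω', X ω' ∂P) : ℝ)‖ ^ 2) ∂P ≤
      (n : ℝ)⁻¹ * (2 * C₁ * (∑' j, κ j) + 2 * C₁ + 1) * V' := by
    rw [← hwκ, Finset.mul_sum]
    refine Finset.sum_le_sum fun k hk => ?_
    rw [integral_const_mul, integral_add (h3 k).1 (h4 k).1, (h4 k).2]
    have := mul_le_mul_of_nonneg_left (add_le_add_left (h3 k).2 ((n : ℝ)⁻¹ * κ k)) (hw0 k hk)
    linarith
  have hT0 : 0 ≤ ∑' j, κ j := tsum_nonneg fun j => (hpos j).le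
  have hn0 : (0 : ℝ) ≤ (n : ℝ)⁻¹ := by positivity
  have h6 : ∫ ω, ‖D (X ω - ∫ ω', X ω' ∂P)‖ ^ 2 ∂P ≤ A := hDU.2.trans hA
  rw [e2]
  calc _ ≤ 40 * ((n : ℝ)⁻¹ * (C₁ * A)) + 40 * ((n : ℝ)⁻¹ * A) +
        16 * V' * ((n : ℝ)⁻¹ * (2 * C₁ * (∑' j, κ j) + 2 * C₁ + 1) * V') := by
        gcongr
        exact e1.trans (by gcongr)
    _ = (n : ℝ)⁻¹ * (40 * (C₁ + 1) * A +
          16 * (2 * C₁ * (∑' j, κ j) + 2 * C₁ + 1) * V' ^ 2) := by ring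
    _ ≤ _ := by gcongr

end ErrorBound

/-! ### The rate for general truncation levels -/

/-- The sequence eventually equals `(n^(1/(2α+2)) / m)^(2α+2)`, whose base tends to infinity. -/
theorem tendsto_mul_rpow_sq_atTop {α : ℝ} (hα : 0 < 2 * α + 2) {m : ℕ → ℕ}
    (hm : Tendsto m atTop atTop)
    (hlo : (fun n => (m n : ℝ)) =o[atTop] fun n : ℕ => (n : ℝ) ^ (1 / (2 * α + 2))) :
    Tendsto (fun n : ℕ => (n : ℝ) * ((m n : ℝ) ^ (-α - 1)) ^ 2) atTop atTop := by
  have h1 := hlo.tendsto_div_nhds_zero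
  have hmpos : ∀ᶠ n in atTop, 0 < m n := hm.eventually_gt_atTop 0
  have h2 : Tendsto (fun n : ℕ => (m n : ℝ) / (n : ℝ) ^ (1 / (2 * α + 2))) atTop (𝓝[>] 0) := by
    refine tendsto_nhdsWithin_iff.2 ⟨h1, ?_⟩
    filter_upwards [hmpos, eventually_gt_atTop 0] with n h3 h4
    have h5 : (0 : ℝ) < m n := by exact_mod_cast h3
    have h6 : (0 : ℝ) < n := by exact_mod_cast h4
    exact Set.mem_Ioi.2 (by positivity)
  refine ((tendsto_rpow_atTop hα).comp (tendsto_inv_nhdsGT_zero.comp h2)).congr' ?_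
  filter_upwards [hmpos, eventually_gt_atTop 0] with n h3 h4
  have h5 : (0 : ℝ) < m n := by exact_mod_cast h3
  have h6 : (0 : ℝ) < n := by exact_mod_cast h4
  simp only [Function.comp_apply, inv_div]
  rw [Real.div_rpow (by positivity) h5.le, ← Real.rpow_mul h6.le, one_div_mul_cancel hα.ne',
    Real.rpow_one, ← Real.rpow_natCast, ← Real.rpow_mul h5.le, div_eq_mul_inv,
    ← Real.rpow_neg h5.le]
  congr 2
  push_cast; ring

section Rate

variable {Ω : Type*} [mΩ : MeasurableSpace Ω] {P : Measure Ω} [IsProbabilityMeasure P]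

theorem isBigOP_bHat {X Y : Ω → L2I} (hX : Measurable X)
    (hX2 : MemLp X 2 P) (hY2 : MemLp Y 2 P) {b : L2I2} (hmodel : FunctionalLinearModel P X Y b)
    {κ : ℕ → ℝ} {φ : HilbertBasis ℕ ℝ L2I} (hK : IsSpectralExpansion (covFun P X) κ φ)
    {α β γ C₁ : ℝ} (hα : 1 < α) (hβ : α / 2 + 1 < β) (hγ : 1 / 2 < γ) (hC₁ : 1 < C₁)
    (hE : ∀ᵐ ω ∂P, condErrorVar P X Y ω ≤ C₁)
    (hξ : ∀ k, MemLp (score P X φ k) 4 P ∧ ∫ ω, score P X φ k ω ^ 4 ∂P ≤ C₁ * κ k ^ 2)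
    (hκ : ∀ k : ℕ, κ k ≤ C₁ * ((k : ℝ) + 1) ^ (-α))
    (hgap : ∀ k : ℕ, C₁⁻¹ * ((k : ℝ) + 1) ^ (-α - 1) ≤ κ k - κ (k + 1))
    (hb : ∀ j k : ℕ, |coef φ b j k| ≤ C₁ * ((j : ℝ) + 1) ^ (-γ) * ((k : ℝ) + 1) ^ (-β))
    {Xs Ys : ℕ → Ω → L2I} (hindep : iIndepFun (fun i ω => (Xs i ω, Ys i ω)) P)
    (hident : ∀ i, IdentDistrib (fun ω => (Xs i ω, Ys i ω)) (fun ω => (X ω, Y ω)) P P)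
    {κh : ℕ → Ω → ℕ → ℝ} {φh : ℕ → Ω → HilbertBasis ℕ ℝ L2I}
    (hKh : ∀ n ω, IsSpectralExpansion (empCov n (fun i => Xs i ω)) (κh n ω) (φh n ω))
    {m : ℕ → ℕ} (hm : Tendsto m atTop atTop)
    (hlo : (fun n => (m n : ℝ)) =o[atTop] fun n : ℕ => (n : ℝ) ^ (1 / (2 * α + 2))) :
    IsBigOP P
      (fun n ω => ‖bHat n (m n) (fun i => Xs i ω) (fun i => Ys i ω) (κh n ω) (φh n ω) - b‖ ^ 2)
      (fun n => (n : ℝ)⁻¹ * (m n : ℝ) ^ (α + 1) + (m n : ℝ) ^ (-2 * β + 1)) := by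
  have hC0 : 0 < C₁ := by linarith
  have hanti : StrictAnti κ := strictAnti_nat_of_succ_lt fun k => by
    have h1 : 0 < C₁⁻¹ * ((k : ℝ) + 1) ^ (-α - 1) := by positivity
    linarith [hgap k]
  have hpos : ∀ k, 0 < κ k := fun k => (hK.nonneg (k + 1)).trans_lt (hanti k.lt_succ_self)
  have hs : Summable κ := summable_eigenvalue hα hK.nonneg hκ
  have hκC : ∀ k, κ k ≤ C₁ := fun k => (hκ k).trans <| by
    have : ((k : ℝ) + 1) ^ (-α) ≤ 1 :=
      Real.rpow_le_one_of_one_le_of_nonpos (by linarith [k.cast_nonneg (α := ℝ)]) (by linarith)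
    exact mul_le_of_le_one_right hC0.le this
  set G : ℝ := C₁ ^ 2 * ∑' j : ℕ, ((j : ℝ) + 1) ^ (-(2 * γ)) with hG
  have hG0 : 0 ≤ G := mul_nonneg (sq_nonneg _) (tsum_nonneg fun j => by positivity)
  have hv := norm_op_sq_le (b := b) (φ := φ) hγ hb
  obtain ⟨V, hV⟩ := exists_perturbationWeight_le hα hβ hC0 hG0 hv hκ hgap
  choose D hD using fun n => hK.exists_resolvent (hpos (m n - 1))
  set cA : ℝ := C₁ * α + C₁ ^ 3 * α ^ 2 * (α - 1)⁻¹ with hcA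
  have hcA0 : 0 ≤ cA := by
    have : 0 ≤ (α - 1)⁻¹ := inv_nonneg.2 (by linarith)
    positivity
  have hT0 : 0 ≤ ∑' j, κ j := tsum_nonneg hK.nonneg
  set c₁ : ℝ := 40 * (C₁ + 1) * cA with hc₁
  set c₂ : ℝ := 16 * (2 * C₁ * (∑' j, κ j) + 2 * C₁ + 1) * V ^ 2 with hc₂
  set c₃ : ℝ := 2 * (G * (2 * β - 1)⁻¹) with hc₃
  have hc₁0 : 0 ≤ c₁ := by positivity
  have hc₂0 : 0 ≤ c₂ := by positivity
  have hc₃0 : 0 ≤ c₃ := by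
    have : 0 ≤ (2 * β - 1)⁻¹ := inv_nonneg.2 (by linarith)
    positivity
  set g : ℕ → ℝ := fun n => κ (m n - 1) - κ (m n) with hg
  have hm1 : ∀ᶠ n in atTop, 1 ≤ m n := hm.eventually_ge_atTop 1
  have hgpos : ∀ᶠ n in atTop, 0 < g n := hm1.mono fun n hn => sub_pos.2 (hanti (by omega))
  have hgC : ∀ n, g n ≤ C₁ := fun n => by
    have := hκC (m n - 1)
    have := hK.nonneg (m n)
    simp only [hg]
    linarith
  -- The covariance error is of order `n^(-1/2)` and has to be small against the gap `g n`, which is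
  -- at least `C₁⁻¹ m^(-α-1)`.
  have hng2 : Tendsto (fun n : ℕ => (n : ℝ) * g n ^ 2) atTop atTop := by
    refine tendsto_atTop_mono' _ ?_
      ((tendsto_mul_rpow_sq_atTop (by linarith) hm hlo).const_mul_atTop
        (show (0 : ℝ) < C₁⁻¹ ^ 2 by positivity))
    filter_upwards [hm1] with n hn
    have h1 := hgap (m n - 1)
    rw [Nat.cast_sub hn, Nat.cast_one, sub_add_cancel, Nat.sub_add_cancel hn] at h1
    have h2 : (C₁⁻¹ * (m n : ℝ) ^ (-α - 1)) ^ 2 ≤ g n ^ 2 := by gcongr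
    have h3 := mul_le_mul_of_nonneg_left h2 (Nat.cast_nonneg (α := ℝ) n)
    linarith
  have hng : Tendsto (fun n : ℕ => (n : ℝ) * g n) atTop atTop := by
    refine tendsto_atTop_mono' _ ?_ (hng2.const_mul_atTop (inv_pos.2 hC0))
    filter_upwards [hgpos] with n hn
    rw [inv_mul_le_iff₀ hC0]
    have h1 := mul_le_mul_of_nonneg_left (hgC n)
      (mul_nonneg (Nat.cast_nonneg (α := ℝ) n) hn.le)
    linarith
  set M : L2I := ∫ ω, X ω ∂P with hM
  have hu : ∀ᶠ n : ℕ in atTop, Integrable (fun ω => ‖average n fun i => Xs i ω - M‖ ^ 2) P ∧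
      (∀ ω, 0 ≤ ‖average n fun i => Xs i ω - M‖ ^ 2) ∧
      ∫ ω, ‖average n fun i => Xs i ω - M‖ ^ 2 ∂P ≤
        (n : ℝ)⁻¹ * ∫ ω, ‖X ω - M‖ ^ 2 ∂P := by
    filter_upwards [eventually_ne_atTop 0] with n hn
    obtain ⟨h1, h2⟩ := integral_average_center_sq hindep hident hX2
      (ContinuousLinearMap.id ℝ L2I) hn
    exact ⟨h1, fun ω => sq_nonneg _, h2.le⟩
  have he : ∀ᶠ n : ℕ in atTop,
      Integrable (fun ω => ‖average n fun i => noise P X Y b (Xs i ω, Ys i ω)‖ ^ 2) P ∧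
      (∀ ω, 0 ≤ ‖average n fun i => noise P X Y b (Xs i ω, Ys i ω)‖ ^ 2) ∧
      ∫ ω, ‖average n fun i => noise P X Y b (Xs i ω, Ys i ω)‖ ^ 2 ∂P ≤
        (n : ℝ)⁻¹ * ∫ ω, ‖noise P X Y b (X ω, Y ω)‖ ^ 2 ∂P := by
    filter_upwards [eventually_ne_atTop 0] with n hn
    obtain ⟨h1, h2⟩ := integral_average_noise_sq hindep hident hX hX2 hY2 hmodel hn
    exact ⟨h1, fun ω => sq_nonneg _, h2.le⟩
  have hΔ : ∀ᶠ n : ℕ in atTop,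
      Integrable (fun ω => ‖average n fun i =>
        tensor (Xs i ω - M) (Xs i ω - M) - covFun P X‖ ^ 2) P ∧
      (∀ ω, 0 ≤ ‖average n fun i => tensor (Xs i ω - M) (Xs i ω - M) - covFun P X‖ ^ 2) ∧
      ∫ ω, ‖average n fun i => tensor (Xs i ω - M) (Xs i ω - M) - covFun P X‖ ^ 2 ∂P ≤
        (n : ℝ)⁻¹ * (2 * ∫ ω, ‖tensor (X ω - M) (X ω - M)‖ ^ 2 ∂P + 2 * ‖covFun P X‖ ^ 2) := by
    filter_upwards [eventually_ne_atTop 0] with n hn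
    obtain ⟨h1, h2⟩ := integral_average_covariance_sq_le hindep hident hX2
      (integral_norm_center_pow_four hX2 hpos hs hξ).1 (ContinuousLinearMap.id ℝ L2I2) hn
    exact ⟨h1, fun ω => sq_nonneg _, h2⟩
  have hn1 : Tendsto (fun n : ℕ => (n : ℝ) * 1) atTop atTop := by
    simpa using tendsto_natCast_atTop_atTop (R := ℝ)
  have hB1 := tendsto_measure_ge_zero (t := fun n => (g n / 4) ^ 2) hΔ
    (hgpos.mono fun n hn => by positivity)
    ((hng2.atTop_div_const (show (0 : ℝ) < 16 by norm_num)).congr fun n => by ring)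
  have hB2 := tendsto_measure_ge_zero (t := fun n => g n / 4) hu
    (hgpos.mono fun n hn => by positivity)
    ((hng.atTop_div_const (show (0 : ℝ) < 4 by norm_num)).congr fun n => by ring)
  have hB3 := tendsto_measure_ge_zero (t := fun _ => 1) hu (Eventually.of_forall fun _ => one_pos) hn1
  have hB4 := tendsto_measure_ge_zero (t := fun _ => 1) he (Eventually.of_forall fun _ => one_pos) hn1
  have hB := (hB1.add hB2).add (hB3.add hB4)
  simp only [add_zero] at hB
  refine isBigOP_of_good_event (T := fun n ω =>
      errorBound P X Y b κ φ (D n) n (m n) (fun i => Xs i ω) (fun i => Ys i ω))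
    (show 0 < c₁ + c₂ + c₃ + 1 by positivity)
    (tendsto_of_tendsto_of_tendsto_of_le_of_le tendsto_const_nhds hB (fun _ => zero_le)
      fun n => (measure_union_le _ _).trans
        (add_le_add (measure_union_le _ _) (measure_union_le _ _))) ?_
  filter_upwards [eventually_ne_atTop 0, hm1, hgpos] with n hn hmn hgn
  have hm0 : (1 : ℝ) ≤ m n := by exact_mod_cast hmn
  have hmpow : 1 ≤ (m n : ℝ) ^ (α + 1) := Real.one_le_rpow hm0 (by linarith)
  have hbias := norm_sub_truncKernel_sq_le (by linarith) hG0 hv hmn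
  have hbpos : 0 < (m n : ℝ) ^ (-2 * β + 1) := by positivity
  have hvpos : 0 < (n : ℝ)⁻¹ * (m n : ℝ) ^ (α + 1) := by positivity
  obtain ⟨hA1, hA2⟩ := tsum_eigenvalue_div_sq_le hα hC0 hK.tendsto_zero hK.nonneg hκ hgap hmn
  obtain ⟨hTi, hTe⟩ := integral_errorBound_le hindep hident hX hX2 hY2 hmodel hK hC0.le hE hpos hs
    hκC hξ (hD n) hA1 hA2 (hV (m n)) hn
  refine ⟨by positivity, hTi, fun ω => errorBound_nonneg _ _ _ _ hK.antitone _ _ _ _ _,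
    hTe.trans ?_, fun ω hω => ?_⟩
  -- The perturbation term is only `O(n⁻¹)`, hence dominated by the variance since `m ≥ 1`.
  · have h1 : (n : ℝ)⁻¹ * c₂ ≤ c₂ * ((n : ℝ)⁻¹ * (m n : ℝ) ^ (α + 1)) := by
      have := mul_le_mul_of_nonneg_left hmpow (show 0 ≤ (n : ℝ)⁻¹ * c₂ by positivity)
      linarith
    have h2 : 0 ≤ (c₁ + c₂) * (m n : ℝ) ^ (-2 * β + 1) := by positivity
    have h3 : 0 ≤ (c₃ + 1) * ((n : ℝ)⁻¹ * (m n : ℝ) ^ (α + 1) + (m n : ℝ) ^ (-2 * β + 1)) := by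
      positivity
    have h4 : (n : ℝ)⁻¹ * (40 * (C₁ + 1) * (cA * (m n : ℝ) ^ (α + 1)) + c₂) =
        c₁ * ((n : ℝ)⁻¹ * (m n : ℝ) ^ (α + 1)) + (n : ℝ)⁻¹ * c₂ := by rw [hc₁]; ring
    rw [h4]
    linarith
  · simp only [Set.mem_union, Set.mem_ofPred_eq, not_or, not_le] at hω
    obtain ⟨⟨hω1, hω2⟩, hω3, hω4⟩ := hω
    have hω1' := (pow_lt_pow_iff_left₀ (norm_nonneg _) (by positivity) two_ne_zero).1 hω1
    -- Centring at the sample mean moves `b` applied to `x̄ - E X` into the intercept, which the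
    -- estimator does not see.
    have hy : ∀ i, Ys i ω = (∫ ω, Y ω ∂P + op b (sampleMean n (fun i => Xs i ω) - M)) +
        op b (Xs i ω - sampleMean n (fun i => Xs i ω)) + noise P X Y b (Xs i ω, Ys i ω) := by
      intro i
      simp only [noise, map_sub, ← hM]
      abel
    have h1 := norm_sq_bHat_sub_le_of_good hn (by omega) hK hanti (hKh n ω) hy (hD n) hω1'.le
      hω2.le hω3.le hω4.le
    have h2 : 0 ≤ (c₁ + c₂ + 1) * ((n : ℝ)⁻¹ * (m n : ℝ) ^ (α + 1) + (m n : ℝ) ^ (-2 * β + 1)) := by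
      positivity
    have h3 : 0 ≤ c₃ * ((n : ℝ)⁻¹ * (m n : ℝ) ^ (α + 1)) := by positivity
    have h4 : 2 * ‖b - truncKernel φ b (m n)‖ ^ 2 ≤ c₃ * (m n : ℝ) ^ (-2 * β + 1) := by
      rw [hc₃]; linarith
    rw [abs_of_nonneg (sq_nonneg _)]
    refine h1.trans ?_
    rw [errorBound]
    linarith

end Rate

/-! ### The balanced truncation level -/

theorem exists_mul_le_of_isTheta {m : ℕ → ℕ} {p : ℝ}
    (h : (fun n => (m n : ℝ)) =Θ[atTop] fun n : ℕ => (n : ℝ) ^ p) :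
    ∃ c C : ℝ, 0 < c ∧ 0 < C ∧ ∀ᶠ n : ℕ in atTop,
      c * (n : ℝ) ^ p ≤ m n ∧ (m n : ℝ) ≤ C * (n : ℝ) ^ p := by
  obtain ⟨C, hC, h1⟩ := h.1.exists_pos
  obtain ⟨c, hc, h2⟩ := h.2.exists_pos
  refine ⟨c⁻¹, C, by positivity, hC, ?_⟩
  filter_upwards [h1.bound, h2.bound] with n h3 h4
  have h5 : ‖(n : ℝ) ^ p‖ = (n : ℝ) ^ p := Real.norm_of_nonneg (by positivity)
  rw [Real.norm_natCast, h5] at h3 h4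
  exact ⟨by rwa [inv_mul_le_iff₀ hc], h3⟩

/-- Variance and bias balance: `-1 + (α + 1) / (α + 2β) = -(2β - 1) / (α + 2β)`. The variance uses
the upper bound on `m`, the bias, with its negative exponent, the lower one. -/
theorem exists_rate_le {α β : ℝ} (hα : 1 < α) (hβ : α / 2 + 1 < β) {m : ℕ → ℕ}
    (h : (fun n => (m n : ℝ)) =Θ[atTop] fun n : ℕ => (n : ℝ) ^ (1 / (α + 2 * β))) :
    ∃ c : ℝ, 0 < c ∧ ∀ᶠ n : ℕ in atTop,
      (n : ℝ)⁻¹ * (m n : ℝ) ^ (α + 1) + (m n : ℝ) ^ (-2 * β + 1) ≤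
        c * (n : ℝ) ^ (-(2 * β - 1) / (α + 2 * β)) := by
  obtain ⟨c, C, hc, hC, h1⟩ := exists_mul_le_of_isTheta h
  refine ⟨C ^ (α + 1) + c ^ (-2 * β + 1), by positivity, ?_⟩
  filter_upwards [h1, eventually_gt_atTop 0] with n ⟨h2, h3⟩ hn
  have hn0 : (0 : ℝ) < n := by exact_mod_cast hn
  have hp : 0 < α + 2 * β := by linarith
  rw [add_mul]
  refine add_le_add ?_ ?_
  · calc _ ≤ (n : ℝ)⁻¹ * (C * (n : ℝ) ^ (1 / (α + 2 * β))) ^ (α + 1) := by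
          gcongr
      _ = C ^ (α + 1) * ((n : ℝ) ^ (-1 : ℝ) * (n : ℝ) ^ (1 / (α + 2 * β) * (α + 1))) := by
          rw [Real.mul_rpow hC.le (by positivity), ← Real.rpow_mul hn0.le, Real.rpow_neg_one]
          ring
      _ = _ := by
          rw [← Real.rpow_add hn0]
          congr 2
          field_simp
          ring
  · calc _ ≤ (c * (n : ℝ) ^ (1 / (α + 2 * β))) ^ (-2 * β + 1) :=
          Real.rpow_le_rpow_of_nonpos (by positivity) h2 (by linarith)
      _ = _ := by
          rw [Real.mul_rpow hc.le (by positivity), ← Real.rpow_mul hn0.le]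
          congr 2
          field_simp
          ring

theorem tendsto_atTop_of_isTheta {m : ℕ → ℕ} {p : ℝ} (hp : 0 < p)
    (h : (fun n => (m n : ℝ)) =Θ[atTop] fun n : ℕ => (n : ℝ) ^ p) : Tendsto m atTop atTop := by
  obtain ⟨c, C, hc, -, h1⟩ := exists_mul_le_of_isTheta h
  refine (tendsto_natCast_atTop_iff (R := ℝ)).1 ?_
  exact tendsto_atTop_mono' _ (h1.mono fun n hn => hn.1)
    (((tendsto_rpow_atTop hp).comp tendsto_natCast_atTop_atTop).const_mul_atTop hc)

theorem isLittleO_natCast_rpow {p q : ℝ} (hpq : p < q) :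
    (fun n : ℕ => (n : ℝ) ^ p) =o[atTop] fun n : ℕ => (n : ℝ) ^ q := by
  refine isLittleO_of_tendsto' ?_ ?_
  · filter_upwards [eventually_gt_atTop 0] with n hn h0
    have : (0 : ℝ) < n := by exact_mod_cast hn
    exact absurd h0 (Real.rpow_pos_of_pos this q).ne'
  · refine ((tendsto_rpow_neg_atTop (sub_pos.2 hpq)).comp tendsto_natCast_atTop_atTop).congr' ?_
    filter_upwards [eventually_gt_atTop 0] with n hn
    have : (0 : ℝ) < n := by exact_mod_cast hn
    rw [Function.comp_apply, ← Real.rpow_sub this, neg_sub]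

end FunctionalRegression

end

theorem theorem1
    {Ω : Type*} [MeasurableSpace Ω] (P : Measure Ω) [IsProbabilityMeasure P]
    -- the pair `(X, Y)`, with finite second moments, and the regression model
    (X Y : Ω → L2I) (hX : Measurable X) (hY : Measurable Y)
    (hX2 : MemLp X 2 P) (hY2 : MemLp Y 2 P)
    (b : L2I2) (hmodel : FunctionalLinearModel P X Y b)
    -- the spectral expansion of the covariance function of `X`
    (κ : ℕ → ℝ) (φ : HilbertBasis ℕ ℝ L2I) (hK : IsSpectralExpansion (covFun P X) κ φ)
    -- the regularity conditions
    (α β γ C₁ : ℝ) (hα : 1 < α) (hβ : α / 2 + 1 < β) (hγ : 1 / 2 < γ) (hC₁ : 1 < C₁)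
    (hE : ∀ᵐ ω ∂P, condErrorVar P X Y ω ≤ C₁)
    (hξ : ∀ k, MemLp (score P X φ k) 4 P ∧ ∫ ω, score P X φ k ω ^ 4 ∂P ≤ C₁ * κ k ^ 2)
    (hκ : ∀ k : ℕ, κ k ≤ C₁ * ((k : ℝ) + 1) ^ (-α))
    (hgap : ∀ k : ℕ, C₁⁻¹ * ((k : ℝ) + 1) ^ (-α - 1) ≤ κ k - κ (k + 1))
    (hb : ∀ j k : ℕ, |coef φ b j k| ≤ C₁ * ((j : ℝ) + 1) ^ (-γ) * ((k : ℝ) + 1) ^ (-β))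
    -- independent copies of `(X, Y)`
    (Xs Ys : ℕ → Ω → L2I) (hXs : ∀ i, Measurable (Xs i)) (hYs : ∀ i, Measurable (Ys i))
    (hindep : iIndepFun (fun i ω => (Xs i ω, Ys i ω)) P)
    (hident : ∀ i, IdentDistrib (fun ω => (Xs i ω, Ys i ω)) (fun ω => (X ω, Y ω)) P P)
    -- for every sample size `n`, a spectral expansion of the empirical covariance function
    (κh : ℕ → Ω → ℕ → ℝ) (φh : ℕ → Ω → HilbertBasis ℕ ℝ L2I)
    (hKh : ∀ n ω, IsSpectralExpansion (empCov n (fun i => Xs i ω)) (κh n ω) (φh n ω)) :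
    (∀ m : ℕ → ℕ, Tendsto m atTop atTop →
      ((fun n => (m n : ℝ)) =o[atTop] fun n => (n : ℝ) ^ (1 / (2 * α + 2))) →
      IsBigOP P
        (fun n ω => ‖bHat n (m n) (fun i => Xs i ω) (fun i => Ys i ω) (κh n ω) (φh n ω) - b‖ ^ 2)
        (fun n => (n : ℝ)⁻¹ * (m n : ℝ) ^ (α + 1) + (m n : ℝ) ^ (-2 * β + 1))) ∧
    (∀ m : ℕ → ℕ,
      ((fun n => (m n : ℝ)) =Θ[atTop] fun n => (n : ℝ) ^ (1 / (α + 2 * β))) →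
      IsBigOP P
        (fun n ω => ‖bHat n (m n) (fun i => Xs i ω) (fun i => Ys i ω) (κh n ω) (φh n ω) - b‖ ^ 2)
        (fun n => (n : ℝ) ^ (-(2 * β - 1) / (α + 2 * β)))) := by
  refine ⟨fun m hm hlo => isBigOP_bHat hX hX2 hY2 hmodel hK hα hβ hγ hC₁ hE hξ hκ hgap hb hindep
    hident hKh hm hlo, fun m hm => ?_⟩
  obtain ⟨c, hc, hrate⟩ := exists_rate_le hα hβ hm
  refine IsBigOP.mono_rate hc (isBigOP_bHat hX hX2 hY2 hmodel hK hα hβ hγ hC₁ hE hξ hκ hgap hb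
    hindep hident hKh (tendsto_atTop_of_isTheta (one_div_pos.2 (by linarith)) hm) ?_) hrate
  -- The balanced level is admissible because `β > α / 2 + 1` says `2α + 2 < α + 2β`.
  exact hm.1.trans_isLittleO
    (isLittleO_natCast_rpow (one_div_lt_one_div_of_lt (by linarith) (by linarith)))
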